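/- Model. Let $Y=(Y_1,\dots,Y_d)$ with $Y_i=\theta_i+\sigma\xi_i$, where $\theta\in\mathbb R^d$, $\sigma>0$ is known, and $\xi_1,\dots,\xi_d$ are i.i.d. with unknown law $P_\xi$. Write $\mathbf E_{\theta,P_\xi,\sigma}$ for the expectation under the law of $Y$, $\|\theta\|_0$ for the number of non-zero coordinates of $\theta$ and $\|\theta\|_2$ for its Euclidean norm. For $a,\tau>0$ let $\mathcal G_{a,\tau}$ be the set of laws $P_\xi$ on $\mathbb R$ with $\mathbf E\xi_1=0$, $\mathbf E\xi_1^2=1$ and $\mathbf P(|\xi_1|>t)\le 2e^{-(t/\tau)^a}$ for all $t\ge 2$. Let $\mathcal L$ be the set of non-decreasing functions $\ell:[0,\infty)\to[0,\infty)$ with $\ell(0)=0$ and $\ell\not\equiv 0$. For integers $1\le s\le d$ set $$\phi(s,d)=\min\{\sqrt s\,\log^{1/a}(ed/s),\ d^{1/4}\}.$$ Estimator. Let $\gamma\in(0,1/2]$ and $m=\lfloor\gamma d\rfloor\ge 1$. Partition $\{1,\dots,d\}$ into $m$ disjoint blocks $B_1,\dots,B_m$ with $|B_i|\ge\lfloor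 d/m\rfloor$, and let $\tilde\sigma^2$ be a (measurable) median of the $m$ numbers $|B_i|^{-1}\sum_{j\in B_i}Y_j^2$. For $c>0$ put $\lambda_j=c\log^{1/a}(ed/j)$ and $\|\theta\|_*=\sum_{j=1}^d\lambda_j|\theta|_{(d-j+1)}$, where $|\theta|_{(1)}\le\dots\le|\theta|_{(d)}$ are the ordered values of $|\theta_1|,\dots,|\theta_d|$, and let $$\hat\theta\in\arg\min_{\theta\in\mathbb R^d}\Big(\sum_{i=1}^d(Y_i-\theta_i)^2+\tilde\sigma\|\theta\|_*\Big).$$ Define $$\hat N=\begin{cases}\|\hat\theta\|_2 & \text{if } s\le \sqrt d/\log^{2/a}(ed),\\[2pt] \big|\sum_{j=1}^dY_j^2-d\sigma^2\big|^{1/2} & \text{if } s>\sqrt d/\log^{2/a}(ed).\end{cases}$$ Proposition. Let $a,\tau>0$. (i) There exist constants $\gamma\in(0,1/2]$, $c>0$ and $C>0$ depending only on $(a,\tau)$ such that for all integers $s,d$ with $1\le s<\lfloor\gamma d\rfloor/4$, all $\sigma>0$, and the estimator $\hat N$ above built with these $\gamma$ and $c$ (for any admissible choice of the blocks and of the median),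 $$\sup_{P_\xi\in\mathcal G_{a,\tau}}\ \sup_{\|\theta\|_0\le s}\mathbf E_{\theta,P_\xi,\sigma}\big(\hat N-\|\theta\|_2\big)^2\le C\sigma^2\phi(s,d)^2 .$$ (ii) For every $\ell\in\mathcal L$ there exist constants $c>0$, $c'>0$ depending only on $\ell,a,\tau$ such that for all integers $1\le s\le d$ and all $\sigma>0$, $$\inf_{\hat T}\ \sup_{P_\xi\in\mathcal G_{a,\tau}}\ \sup_{\|\theta\|_0\le s}\mathbf E_{\theta,P_\xi,\sigma}\,\ell\Big(c\,\phi(s,d)^{-1}\,\Big|\frac{\hat T-\|\theta\|_2}{\sigma}\Big|\Big)\ge c',$$ where $\inf_{\hat T}$ is the infimum over all estimators, i.e. all measurable real-valued functions of $Y$ (which may depend on $\sigma$, $s$, $d$, $a$, $\tau$). -/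

import Mathlib

open MeasureTheory
open scoped NNReal ENNReal

noncomputable section

namespace SparseNorm

/-- The class `G_{a,τ}` of noise laws: probability measures on `ℝ` with mean `0`, second moment `1`
and exponential tails `P(|ξ| > t) ≤ 2 exp (-(t/τ)^a)` for all `t ≥ 2`. -/
def noiseClass (a τ : ℝ) : Set (Measure ℝ) :=
  {P | IsProbabilityMeasure P ∧ MemLp (fun x : ℝ => x) 2 P ∧
    ∫ x, x ∂P = 0 ∧ ∫ x, x ^ 2 ∂P = 1 ∧
    ∀ t : ℝ, 2 ≤ t → P.real {x | t < |x|} ≤ 2 * Real.exp (-(t / τ) ^ a)}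

/-- The law of `Y = θ + σ ξ`, where the coordinates of `ξ` are i.i.d. with law `P`. -/
def law {d : ℕ} (θ : Fin d → ℝ) (P : Measure ℝ) (σ : ℝ) : Measure (Fin d → ℝ) :=
  (Measure.pi (fun _ : Fin d => P)).map (fun ξ i => θ i + σ * ξ i)

/-- The Euclidean norm of a vector. -/
def l2norm {d : ℕ} (θ : Fin d → ℝ) : ℝ := √(∑ i, θ i ^ 2)

/-- The set `Θ_s` of `s`-sparse vectors in `ℝ^d`. -/
def sparse (d s : ℕ) : Set (Fin d → ℝ) :=
  {θ | (Finset.univ.filter (fun i => θ i ≠ 0)).card ≤ s}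

/-- The loss functions: non-decreasing `ℓ : [0,∞) → [0,∞)` with `ℓ 0 = 0`, not identically zero. -/
def lossClass : Set (ℝ≥0 → ℝ≥0) :=
  {ℓ | Monotone ℓ ∧ ℓ 0 = 0 ∧ ∃ t, ℓ t ≠ 0}

/-- `B_1, …, B_m` is a partition of the index set into `m` blocks of at least `⌊d/m⌋` elements. -/
def IsBlockPartition {d m : ℕ} (B : Fin m → Finset (Fin d)) : Prop :=
  Pairwise (fun i j => Disjoint (B i) (B j)) ∧
    Finset.univ.biUnion B = Finset.univ ∧
    ∀ i, d / m ≤ (B i).card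

/-- The mean of the squared observations over the `i`-th block. -/
def blockMean {d m : ℕ} (B : Fin m → Finset (Fin d)) (y : Fin d → ℝ) (i : Fin m) : ℝ :=
  (∑ j ∈ B i, y j ^ 2) / (B i).card

/-- `x` is a median of `v_1, …, v_m`: at least half of them are `≤ x` and at least half are `≥ x`. -/
def IsMedian {m : ℕ} (v : Fin m → ℝ) (x : ℝ) : Prop :=
  m ≤ 2 * (Finset.univ.filter (fun i => v i ≤ x)).card ∧
    m ≤ 2 * (Finset.univ.filter (fun i => x ≤ v i)).card

/-- `v` is a median-of-means estimator of the variance `σ²` built on the blocks `B`. -/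
def IsMedianOfMeans {d m : ℕ} (B : Fin m → Finset (Fin d)) (v : (Fin d → ℝ) → ℝ) : Prop :=
  Measurable v ∧ ∀ y, IsMedian (blockMean B y) (v y)

/-- The order statistics `v_(1) ≤ ⋯ ≤ v_(d)` (with indices starting from `0`). -/
def orderStat {d : ℕ} (v : Fin d → ℝ) (k : Fin d) : ℝ := v (Tuple.sort v k)

/-- The sorted `ℓ¹` norm `∑_{i=1}^d λ_i |θ|_(d-i+1)`: the weight `λ_i` multiplies the `i`-th
largest of the absolute values (indices start from `0`, and `i.rev` is `d - 1 - i`). -/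
def sortedNorm {d : ℕ} (lam : Fin d → ℝ) (θ : Fin d → ℝ) : ℝ :=
  ∑ i, lam i * orderStat (fun j => |θ j|) i.rev

/-- The weights `λ_j = c log^{1/a}(e d / j)`, `j = 1, …, d` (here `j = i + 1`). -/
def weight (a c : ℝ) (d : ℕ) (i : Fin d) : ℝ :=
  c * Real.log (Real.exp 1 * d / ((i : ℕ) + 1)) ^ (1 / a)

/-- `θhat` minimizes `∑ (Y_i - θ_i)² + σ̃ ‖θ‖_*` over `θ ∈ ℝ^d`, where `σ̃² = v(Y)`. -/
def IsSlopeEstimator {d : ℕ} (lam : Fin d → ℝ) (v : (Fin d → ℝ) → ℝ)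
    (θhat : (Fin d → ℝ) → (Fin d → ℝ)) : Prop :=
  Measurable θhat ∧
    ∀ y, IsMinOn (fun θ => ∑ i, (y i - θ i) ^ 2 + √(v y) * sortedNorm lam θ) Set.univ (θhat y)

/-- The estimator of `‖θ‖₂` for known `σ`: the norm of `θhat` in the sparse zone
`s ≤ √d / log^{2/a}(e d)`, and `|∑ Y_j² - d σ²|^{1/2}` in the dense zone. -/
def normEstimator (a σ : ℝ) {d : ℕ} (s : ℕ) (θhat : (Fin d → ℝ) → (Fin d → ℝ))
    (y : Fin d → ℝ) : ℝ :=
  if (s : ℝ) ≤ √d / Real.log (Real.exp 1 * d) ^ (2 / a) then l2norm (θhat y)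
  else √|∑ j, y j ^ 2 - d * σ ^ 2|

/-- The rate `min (√s log^{1/a}(e d / s), d^{1/4})`. -/
def rate (a : ℝ) (s d : ℕ) : ℝ :=
  min (√s * Real.log (Real.exp 1 * d / s) ^ (1 / a)) ((d : ℝ) ^ (1 / 4 : ℝ))

end SparseNorm

end

/-!
Upper bound. In the dense zone the statistic `∑ Y_j² - d σ²` equals `‖θ‖² + A + B` with a cross term
`A = 2 σ ⟨θ, ξ⟩` and a centred sum `B = σ² ∑ (ξ_j² - 1)`. Then `(√|‖θ‖² + A + B| - ‖θ‖)²` is at most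
`2 |B| + 4 A² / ‖θ‖²` (`sq_sqrt_abs_sub_le`), whose expectation is of order `σ² √d`.

In the sparse zone `(‖θhat‖ - ‖θ‖)² ≤ ‖θhat - θ‖²`, and the minimality of `θhat` is combined with the
decomposability of the sorted norm at sparse vectors (`sortedNorm_sub_le`): the penalty absorbs
the noise as soon as the sorted noise is below a quarter of the weights times `σ̃`, and in general
the error is at most `2 R + 2 σ̃ Λ_s`, where `R` is the Euclidean norm of the excess of the sorted
noise over these weights and `Λ_s²` is the sum of the `s` largest squared weights
(`slope_error_le`). Three facts conclude.

* The `j`-th largest noise `z` satisfies `j g(z) ≤ ∑ g(ξ_i)` for `g = expMoment a τ`. So the excess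
  is controlled by the fluctuation of the empirical mean of `g`, whose variance is `O(1 / d)`; the
  sum of the `d` squared excesses is therefore bounded in expectation (`exists_excess_le`).
* At most `s < m / 4` blocks meet the support of `θ`. Hence `σ̃²` is at most four times the average
  over all blocks of the mean squared noise (`median_le`), and `σ̃² < σ² / 4` forces a quarter of the
  blocks to have a small mean squared noise. By a union bound over collections of blocks this has
  probability at most `4 ^ (-m)` (`integral_smallBlocksBound_le`), while `R ≤ σ ‖ξ‖` on
  this event.
* `Λ_s²` is of order `s log ^ (2 / a) (e d / s)` (`exists_sum_weight_sq_le`).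

Lower bound. Let `θ` have independent coordinates equal to `0` with probability `1 - p` and to
`± σ λ` otherwise, with `p = s / (4 d)`, and let the noise be `0` with
probability `1 / 2` and `± √2` otherwise. The law of an
observation then has second moment `σ² (1 + p λ²)`; lowering the weights of `± √2` in its bulk by a
relative amount `ε ≈ p λ²` makes it the law of `σ ξ` for an admissible noise with `θ = 0`
(`tilted_mem_noiseClass`). For `λ √s = κ φ(s, d)` with small `κ`, the tail condition holds because
`λ` is at most a multiple of `log ^ (1 / a) (e d / s)`, and the two product laws are close because
`ε² d` is small (`sum_prod_sub_le`). Since under the prior `‖θ‖₂` is of order `σ λ √s` with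
probability at least `1 / 16` (`le_sum_prod_count`), no estimator can have a small risk under both.
All the laws involved have finitely many atoms, so that probabilities are finite sums.
-/

namespace SparseNorm

/-! ### Non-increasing rearrangements and the sorted norm -/

/-- The non-increasing rearrangement `v_(d) ≥ ⋯ ≥ v_(1)`, indexed from `0`. -/
noncomputable def decSort {d : ℕ} (v : Fin d → ℝ) (j : Fin d) : ℝ := orderStat v j.rev

/-- The permutation that lists the entries of `v` in non-increasing order. -/
noncomputable def decPerm {d : ℕ} (v : Fin d → ℝ) : Equiv.Perm (Fin d) :=
  Fin.revPerm.trans (Tuple.sort v)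

lemma decSort_eq {d : ℕ} (v : Fin d → ℝ) (j : Fin d) : decSort v j = v (decPerm v j) := rfl

lemma decSort_antitone {d : ℕ} (v : Fin d → ℝ) : Antitone (decSort v) := fun _ _ h =>
  Tuple.monotone_sort v (Fin.rev_le_rev.mpr h)

lemma sum_mul_comp_perm_le {d : ℕ} {lam : Fin d → ℝ} (hlam : Antitone lam) (f : Fin d → ℝ)
    (π : Equiv.Perm (Fin d)) : ∑ j, lam j * f (π j) ≤ ∑ j, lam j * decSort f j := by
  have hm : Monovary lam (decSort f) := hlam.monovary (decSort_antitone f)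
  have h := hm.sum_mul_comp_perm_le_sum_mul (σ := π.trans (decPerm f).symm)
  simpa [decSort_eq] using h

lemma comp_perm_eq_decSort {d : ℕ} {f : Fin d → ℝ} {π : Equiv.Perm (Fin d)}
    (h : Antitone (f ∘ π)) (j : Fin d) : f (π j) = decSort f j :=
  congrFun (Tuple.unique_antitone h (τ := decPerm f) (decSort_antitone f)) j

lemma sum_comp_decSort {d : ℕ} (f : Fin d → ℝ) (g : ℝ → ℝ) :
    ∑ j, g (decSort f j) = ∑ i, g (f i) := by
  simp only [decSort_eq]
  exact Equiv.sum_comp (decPerm f) (fun i => g (f i))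

lemma sum_mul_le_sum_decSort {d : ℕ} (f g : Fin d → ℝ) :
    ∑ i, f i * g i ≤ ∑ j, decSort f j * decSort g j := by
  have h := sum_mul_comp_perm_le (decSort_antitone f) g (decPerm f)
  simp only [decSort_eq f] at h ⊢
  rwa [Equiv.sum_comp (decPerm f) (fun i => f i * g i)] at h

lemma decSort_abs_nonneg {d : ℕ} (u : Fin d → ℝ) (j : Fin d) :
    0 ≤ decSort (fun i => |u i|) j := by rw [decSort_eq]; positivity

/-- The first entries of the non-increasing rearrangement dominate the corresponding averages. -/
lemma card_mul_le_sum_of_decSort {d : ℕ} (f : Fin d → ℝ) {g : ℝ → ℝ} (hg : ∀ x, 0 ≤ g x)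
    (hmono : ∀ i j, f i ≤ f j → g (f i) ≤ g (f j)) (j : Fin d) :
    ((j : ℕ) + 1 : ℝ) * g (decSort f j) ≤ ∑ i, g (f i) := by
  rw [← sum_comp_decSort]
  calc ((j : ℕ) + 1 : ℝ) * g (decSort f j) = ∑ i ∈ Finset.Iic j, g (decSort f j) := by
        simp [Fin.card_Iic]
    _ ≤ ∑ i ∈ Finset.Iic j, g (decSort f i) := by
        refine Finset.sum_le_sum fun i hi => ?_
        exact hmono _ _ (decSort_antitone f (Finset.mem_Iic.mp hi))
    _ ≤ _ := Finset.sum_le_sum_of_subset_of_nonneg (Finset.subset_univ _) fun i _ _ => hg _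

/-- Decomposability of the sorted norm at an `s`-sparse vector `θ`: a perturbation `u` decreases
the norm by at most the part of `‖u‖_*` carried by its `s` largest entries, minus the rest. The
lower bound on `‖θ + u‖_*` comes from testing the rearrangement inequality on the permutation that
lists the support of `θ` first, and then the other indices by decreasing `|u i|`. -/
lemma sortedNorm_sub_le {d s : ℕ} {lam : Fin d → ℝ} (hlam : Antitone lam) (h0 : ∀ i, 0 ≤ lam i)
    {θ : Fin d → ℝ} (hθ : θ ∈ sparse d s) (u : Fin d → ℝ) :
    sortedNorm lam θ - sortedNorm lam (fun i => θ i + u i) ≤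
      ∑ j : Fin d, (if (j : ℕ) < s then 1 else -1) * (lam j * decSort (fun i => |u i|) j) := by
  set A : ℝ := ∑ i, |u i| + 1 with hA
  have huA : ∀ i, |u i| < A := fun i => by
    have := Finset.single_le_sum (f := fun i => |u i|) (fun i _ => abs_nonneg _)
      (Finset.mem_univ i)
    linarith
  set w : Fin d → ℝ := fun i => if θ i ≠ 0 then A + |θ i| else |u i| with hw
  set π := decPerm w with hπ
  have hanti : Antitone (w ∘ π) := decSort_antitone w
  have hSmono : ∀ i j, i ≤ j → θ (π j) ≠ 0 → θ (π i) ≠ 0 := by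
    intro i j hij hj hi
    have := hanti hij
    simp only [Function.comp, hw, hj, hi, ne_eq, not_true, if_false, not_false_iff, if_true] at this
    have := huA (π i)
    have := abs_nonneg (θ (π j))
    linarith
  have hSs : ∀ j : Fin d, θ (π j) ≠ 0 → (j : ℕ) < s := by
    intro j hj
    have hsub : (Finset.Iic j).map π.toEmbedding ⊆ Finset.univ.filter (fun i => θ i ≠ 0) := by
      intro i hi
      simp only [Finset.mem_map, Finset.mem_Iic] at hi
      obtain ⟨k, hk, rfl⟩ := hi
      simpa using hSmono k j hk hj
    have := (Finset.card_le_card hsub).trans hθ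
    rw [Finset.card_map, Fin.card_Iic] at this
    omega
  have hθanti : Antitone ((fun i => |θ i|) ∘ π) := by
    intro i j hij
    simp only [Function.comp]
    by_cases hj : θ (π j) = 0
    · simp [hj]
    · have hi := hSmono i j hij hj
      have := hanti hij
      simp only [Function.comp, hw, hj, hi, ne_eq, not_false_iff, if_true] at this
      linarith
  have hut : ∀ j : Fin d, s ≤ (j : ℕ) → decSort (fun i => |u i|) j ≤ |u (π j)| := by
    intro j hj
    by_contra! hlt
    have hj0 : θ (π j) = 0 := by
      by_contra h
      exact absurd (hSs j h) (by omega)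
    have hsub : (Finset.Iic j).map ((decPerm (fun i => |u i|)).trans π.symm).toEmbedding ⊆
        Finset.Iio j := by
      intro i hi
      simp only [Finset.mem_map, Finset.mem_Iic] at hi
      obtain ⟨k, hk, rfl⟩ := hi
      simp only [Finset.mem_Iio]
      by_contra! hle
      have h1 := hanti hle
      simp only [Function.comp, Equiv.coe_toEmbedding, Equiv.trans_apply,
        Equiv.apply_symm_apply] at h1
      have h2 : w (π j) = |u (π j)| := by simp [hw, hj0]
      have h3 := decSort_antitone (fun i => |u i|) hk
      rw [decSort_eq _ k] at h3
      have h4 : |u (decPerm (fun i => |u i|) k)| ≤ w (decPerm (fun i => |u i|) k) := by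
        simp only [hw]
        split_ifs
        · have := huA (decPerm (fun i => |u i|) k)
          have := abs_nonneg (θ (decPerm (fun i => |u i|) k))
          linarith
        · exact le_rfl
      linarith
    have := Finset.card_le_card hsub
    rw [Finset.card_map, Fin.card_Iic, Fin.card_Iio] at this
    omega
  have h1 : sortedNorm lam θ = ∑ j, lam j * |θ (π j)| :=
    Finset.sum_congr rfl fun j _ => by rw [comp_perm_eq_decSort hθanti j]; rfl
  have h2 : ∑ j, lam j * |θ (π j) + u (π j)| ≤ sortedNorm lam (fun i => θ i + u i) :=
    sum_mul_comp_perm_le hlam (fun i => |θ i + u i|) π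
  have hlam' : Antitone (fun j : Fin d => if (j : ℕ) < s then lam j else 0) := by
    intro i j hij
    have : (i : ℕ) ≤ j := hij
    simp only
    split_ifs
    · exact hlam hij
    · omega
    · exact h0 _
    · exact le_rfl
  have h3 := sum_mul_comp_perm_le hlam' (fun i => |u i|) π
  have h4 : ∀ j : Fin d, lam j * |θ (π j)| - lam j * |θ (π j) + u (π j)| ≤
      (if (j : ℕ) < s then lam j else 0) * |u (π j)| -
        (if (j : ℕ) < s then 0 else lam j) * decSort (fun i => |u i|) j := by
    intro j
    split_ifs with hj
    · have : |θ (π j)| ≤ |θ (π j) + u (π j)| + |u (π j)| := by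
        have := abs_sub (θ (π j) + u (π j)) (u (π j))
        simpa using this
      nlinarith [h0 j]
    · have hj0 : θ (π j) = 0 := by
        by_contra h
        exact hj (hSs j h)
      have := mul_le_mul_of_nonneg_left (hut j (by omega)) (h0 j)
      simp only [hj0, abs_zero, zero_add]
      linarith
  have h5 := Finset.sum_le_sum fun j (_ : j ∈ Finset.univ) => h4 j
  rw [Finset.sum_sub_distrib, Finset.sum_sub_distrib] at h5
  have h6 : ∑ j : Fin d, (if (j : ℕ) < s then (1 : ℝ) else -1) *
      (lam j * decSort (fun i => |u i|) j) =
      ∑ j : Fin d, (if (j : ℕ) < s then lam j else 0) * decSort (fun i => |u i|) j -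
      ∑ j : Fin d, (if (j : ℕ) < s then 0 else lam j) * decSort (fun i => |u i|) j := by
    rw [← Finset.sum_sub_distrib]
    refine Finset.sum_congr rfl fun j _ => ?_
    split_ifs <;> ring
  rw [h6]
  linarith

/-! ### Deterministic analysis of the Slope estimator and of the median of means -/

lemma l2norm_eq_norm {d : ℕ} (θ : Fin d → ℝ) : l2norm θ = ‖WithLp.toLp 2 θ‖ := by
  simp [l2norm, EuclideanSpace.norm_eq]

lemma l2norm_nonneg {d : ℕ} (θ : Fin d → ℝ) : 0 ≤ l2norm θ := Real.sqrt_nonneg _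

lemma l2norm_sq {d : ℕ} (θ : Fin d → ℝ) : l2norm θ ^ 2 = ∑ i, θ i ^ 2 :=
  Real.sq_sqrt (Finset.sum_nonneg fun _ _ => sq_nonneg _)

lemma sq_l2norm_sub_le {d : ℕ} (h θ : Fin d → ℝ) :
    (l2norm h - l2norm θ) ^ 2 ≤ l2norm (fun i => h i - θ i) ^ 2 := by
  have := abs_norm_sub_norm_le (WithLp.toLp 2 h) (WithLp.toLp 2 θ)
  rw [← WithLp.toLp_sub, ← l2norm_eq_norm, ← l2norm_eq_norm, ← l2norm_eq_norm] at this
  exact sq_le_sq' (by have := (abs_le.mp this).1; simpa [Pi.sub_def] using this)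
    ((le_abs_self _).trans this)

lemma sum_mul_le_l2norm {d : ℕ} (x y : Fin d → ℝ) : ∑ i, x i * y i ≤ l2norm x * l2norm y :=
  Real.sum_mul_le_sqrt_mul_sqrt _ _ _

lemma l2norm_decSort {d : ℕ} (u : Fin d → ℝ) : l2norm (decSort fun i => |u i|) = l2norm u := by
  unfold l2norm
  rw [sum_comp_decSort (fun i => |u i|) (fun x => x ^ 2)]
  simp

/-- Deterministic error bound for the Slope estimator: the part of the noise `z` exceeding a
quarter of the weights (after sorting) enters through its Euclidean norm, and the rest is absorbed
by the penalty. -/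
lemma slope_error_le {d s : ℕ} {lam : Fin d → ℝ} (hlam : Antitone lam) (h0 : ∀ i, 0 ≤ lam i)
    {θ z h : Fin d → ℝ} (hθ : θ ∈ sparse d s) {t : ℝ} (ht : 0 ≤ t)
    (hmin : ∑ i, (θ i + z i - h i) ^ 2 + t * sortedNorm lam h ≤
      ∑ i, (θ i + z i - θ i) ^ 2 + t * sortedNorm lam θ) :
    l2norm (fun i => h i - θ i) ≤
      2 * l2norm (fun j => max (decSort (fun i => |z i|) j - t * lam j / 4) 0) +
      2 * (t * l2norm (fun j : Fin d => if (j : ℕ) < s then lam j else 0)) := by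
  set u : Fin d → ℝ := fun i => h i - θ i with hu
  set us := decSort (fun i => |u i|) with hus
  set zs := decSort (fun i => |z i|) with hzs
  set r : Fin d → ℝ := fun j => max (zs j - t * lam j / 4) 0 with hr
  set D : Fin d → ℝ := fun j : Fin d => if (j : ℕ) < s then lam j else 0 with hD
  have hus0 : ∀ j, 0 ≤ us j := decSort_abs_nonneg u
  have h1 : ∑ i, u i ^ 2 ≤ 2 * ∑ i, z i * u i +
      t * (sortedNorm lam θ - sortedNorm lam (fun i => θ i + u i)) := by
    have e1 : (fun i => θ i + u i) = h := by ext i; simp [hu]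
    have e2 : ∑ i, (θ i + z i - h i) ^ 2 - ∑ i, (θ i + z i - θ i) ^ 2 =
        ∑ i, u i ^ 2 - 2 * ∑ i, z i * u i := by
      rw [Finset.mul_sum, ← Finset.sum_sub_distrib, ← Finset.sum_sub_distrib]
      exact Finset.sum_congr rfl fun i _ => by simp only [hu]; ring
    rw [e1]
    linarith
  have h2 := mul_le_mul_of_nonneg_left (sortedNorm_sub_le hlam h0 hθ u) ht
  have h3 : ∑ i, z i * u i ≤ ∑ j, zs j * us j :=
    (Finset.sum_le_sum fun i _ => (le_abs_self _).trans (abs_mul _ _).le).trans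
      (sum_mul_le_sum_decSort _ _)
  have h4 : ∀ j : Fin d, 2 * (zs j * us j) + t * ((if (j : ℕ) < s then 1 else -1) * (lam j * us j))
      ≤ 2 * (r j * us j) + 3 / 2 * t * (D j * us j) := by
    intro j
    have hzr : zs j ≤ t * lam j / 4 + r j := by
      have := le_max_left (zs j - t * lam j / 4) 0
      simp only [hr]; linarith
    have h5 := mul_le_mul_of_nonneg_right hzr (hus0 j)
    have h6 : 0 ≤ t * (lam j * us j) := mul_nonneg ht (mul_nonneg (h0 j) (hus0 j))
    simp only [hD]
    split_ifs <;> nlinarith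
  have h5 := Finset.sum_le_sum fun j (_ : j ∈ Finset.univ) => h4 j
  rw [Finset.sum_add_distrib, Finset.sum_add_distrib, ← Finset.mul_sum, ← Finset.mul_sum,
    ← Finset.mul_sum, ← Finset.mul_sum] at h5
  have h6 := sum_mul_le_l2norm r us
  have h7 := sum_mul_le_l2norm D us
  have h8 : l2norm us = l2norm u := l2norm_decSort u
  rw [h8] at h6 h7
  rw [← l2norm_sq] at h1
  have hu0 := l2norm_nonneg u
  have hD0 := l2norm_nonneg D
  have hr0 := l2norm_nonneg r
  have h9 : l2norm u * l2norm u ≤ (2 * l2norm r + 2 * (t * l2norm D)) * l2norm u := by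
    have h10 := mul_le_mul_of_nonneg_left h7 ht
    have h11 : 0 ≤ t * (l2norm D * l2norm u) := by positivity
    nlinarith
  rcases hu0.eq_or_lt with h | h
  · rw [← h]; positivity
  · exact le_of_mul_le_mul_right h9 h

/-- At most `s` blocks meet the support of an `s`-sparse vector, so that half of the blocks contain
a quarter of blocks of pure noise. -/
lemma le_card_clean {d m s : ℕ} {B : Fin m → Finset (Fin d)} (hB : IsBlockPartition B)
    {θ : Fin d → ℝ} (hθ : θ ∈ sparse d s) (hs : 4 * s < m) {T : Finset (Fin m)}
    (hT : m ≤ 2 * T.card) : m ≤ 4 * (T.filter fun i => ∀ j ∈ B i, θ j = 0).card := by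
  have h1 : (T.filter fun i => ¬ ∀ j ∈ B i, θ j = 0).card ≤ s := by
    refine (Finset.card_le_card_of_forall_subsingleton (fun i j => j ∈ B i)
      (fun i hi => ?_) fun j _ i hi i' hi' => ?_).trans hθ
    · have := (Finset.mem_filter.mp hi).2
      push Not at this
      obtain ⟨j, hj, hj0⟩ := this
      exact ⟨j, by simpa using hj0, hj⟩
    · by_contra hne
      exact Finset.disjoint_left.mp (hB.1 hne) hi.2 hi'.2
  have h2 := Finset.card_filter_add_card_filter_not (s := T) (fun i => ∀ j ∈ B i, θ j = 0)
  omega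

lemma blockMean_of_clean {d m : ℕ} {B : Fin m → Finset (Fin d)} {θ ξ : Fin d → ℝ} {σ : ℝ}
    {i : Fin m} (h : ∀ j ∈ B i, θ j = 0) :
    blockMean B (fun j => θ j + σ * ξ j) i = σ ^ 2 * blockMean B ξ i := by
  unfold blockMean
  rw [← mul_div_assoc, Finset.mul_sum]
  congr 1
  exact Finset.sum_congr rfl fun j hj => by simp only [h j hj]; ring

lemma blockMean_nonneg {d m : ℕ} (B : Fin m → Finset (Fin d)) (y : Fin d → ℝ) (i : Fin m) :
    0 ≤ blockMean B y i := by unfold blockMean; positivity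

lemma median_le {d m s : ℕ} {B : Fin m → Finset (Fin d)} (hB : IsBlockPartition B)
    {θ ξ : Fin d → ℝ} (hθ : θ ∈ sparse d s) (hs : 4 * s < m) {σ x : ℝ}
    (hx : IsMedian (blockMean B fun j => θ j + σ * ξ j) x) :
    m * x ≤ 4 * σ ^ 2 * ∑ i, blockMean B ξ i := by
  have hsum : 0 ≤ ∑ i, blockMean B ξ i := Finset.sum_nonneg fun i _ => blockMean_nonneg B ξ i
  rcases le_or_gt x 0 with h0 | h0
  · exact (mul_nonpos_of_nonneg_of_nonpos (by positivity) h0).trans (by positivity)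
  have h1 := le_card_clean hB hθ hs hx.2
  set T := (Finset.univ.filter fun i => x ≤ blockMean B (fun j => θ j + σ * ξ j) i).filter
    fun i => ∀ j ∈ B i, θ j = 0 with hT
  have h2 : T.card • x ≤ ∑ i ∈ T, σ ^ 2 * blockMean B ξ i := by
    refine Finset.card_nsmul_le_sum _ _ _ fun i hi => ?_
    simp only [hT, Finset.mem_filter, Finset.mem_univ, true_and] at hi
    rw [← blockMean_of_clean hi.2]
    exact hi.1
  have h3 : ∑ i ∈ T, σ ^ 2 * blockMean B ξ i ≤ σ ^ 2 * ∑ i, blockMean B ξ i := by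
    rw [Finset.mul_sum]
    exact Finset.sum_le_sum_of_subset_of_nonneg (Finset.subset_univ _) fun i _ _ =>
      mul_nonneg (sq_nonneg _) (blockMean_nonneg B ξ i)
  have h4 : (m : ℝ) ≤ 4 * T.card := by exact_mod_cast h1
  rw [nsmul_eq_mul] at h2
  nlinarith

/-- The noise event on which at least a quarter of the blocks have a mean square below `1 / 4`. -/
def smallBlocks {d m : ℕ} (B : Fin m → Finset (Fin d)) : Set (Fin d → ℝ) :=
  {ξ | m ≤ 4 * (Finset.univ.filter fun i => blockMean B ξ i < 1 / 4).card}

lemma le_median {d m s : ℕ} {B : Fin m → Finset (Fin d)} (hB : IsBlockPartition B)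
    {θ ξ : Fin d → ℝ} (hθ : θ ∈ sparse d s) (hs : 4 * s < m) {σ x : ℝ} 
    (hx : IsMedian (blockMean B fun j => θ j + σ * ξ j) x) (hξ : ξ ∉ smallBlocks B) :
    σ ^ 2 / 4 ≤ x := by
  by_contra! hlt
  refine hξ ((le_card_clean hB hθ hs hx.1).trans ?_)
  refine Nat.mul_le_mul_left 4 (Finset.card_le_card fun i hi => ?_)
  simp only [Finset.mem_filter, Finset.mem_univ, true_and] at hi ⊢
  rw [blockMean_of_clean hi.2] at hi
  have : σ ^ 2 * blockMean B ξ i < σ ^ 2 * (1 / 4) := by linarith [hi.1]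
  exact lt_of_mul_lt_mul_left this (sq_nonneg σ)

lemma median_nonneg {d m : ℕ} {B : Fin m → Finset (Fin d)} {y : Fin d → ℝ} {x : ℝ} (hm : 0 < m)
    (hx : IsMedian (blockMean B y) x) : 0 ≤ x := by
  have h1 : 0 < (Finset.univ.filter fun i => blockMean B y i ≤ x).card := by have := hx.1; omega
  obtain ⟨i, hi⟩ := Finset.card_pos.mp h1
  simp only [Finset.mem_filter, Finset.mem_univ, true_and] at hi
  exact (blockMean_nonneg B y i).trans hi

/-- Pointwise error bound in the sparse zone. The noise outside of `smallBlocks B` is compared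
with the weights `lam / 8`, since there `√x ≥ σ / 2`; on `smallBlocks B` it is not absorbed at
all. -/
lemma slope_sq_error_le {d m s : ℕ} {B : Fin m → Finset (Fin d)} (hB : IsBlockPartition B)
    {lam : Fin d → ℝ} (hlam : Antitone lam) (h0 : ∀ i, 0 ≤ lam i)
    {θ ξ h : Fin d → ℝ} (hθ : θ ∈ sparse d s) (hs : 4 * s < m) {σ x : ℝ} (hσ : 0 < σ)
    (hx : IsMedian (blockMean B fun j => θ j + σ * ξ j) x)
    (hmin : ∑ i, (θ i + σ * ξ i - h i) ^ 2 + √x * sortedNorm lam h ≤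
      ∑ i, (θ i + σ * ξ i - θ i) ^ 2 + √x * sortedNorm lam θ) :
    (l2norm h - l2norm θ) ^ 2 ≤
      8 * σ ^ 2 * (∑ j, max (decSort (fun i => |ξ i|) j - lam j / 8) 0 ^ 2 +
        (smallBlocks B).indicator (fun ξ => ∑ i, ξ i ^ 2) ξ) +
      8 * (x * ∑ j : Fin d, (if (j : ℕ) < s then lam j else 0) ^ 2) := by
  have hx0 : 0 ≤ x := median_nonneg (by omega) hx
  have h1 := slope_error_le hlam h0 hθ (Real.sqrt_nonneg x) hmin
  have h2 := sq_l2norm_sub_le h θ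
  have hz : decSort (fun i => |σ * ξ i|) = fun j => σ * decSort (fun i => |ξ i|) j := by
    ext j
    have : Antitone ((fun i => |σ * ξ i|) ∘ decPerm (fun i => |ξ i|)) := fun i j hij => by
      simp only [Function.comp, abs_mul]
      exact mul_le_mul_of_nonneg_left (decSort_antitone (fun i => |ξ i|) hij) (abs_nonneg _)
    rw [← comp_perm_eq_decSort this, decSort_eq, abs_mul, abs_of_pos hσ]
  set R := l2norm (fun j => max (decSort (fun i => |σ * ξ i|) j - √x * lam j / 4) 0) with hR
  set D := l2norm (fun j : Fin d => if (j : ℕ) < s then lam j else 0) with hD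
  have hr : R ^ 2 ≤ σ ^ 2 * (∑ j, max (decSort (fun i => |ξ i|) j - lam j / 8) 0 ^ 2 +
        (smallBlocks B).indicator (fun ξ => ∑ i, ξ i ^ 2) ξ) := by
    rw [hR, l2norm_sq, mul_add, Finset.mul_sum]
    by_cases hξ : ξ ∈ smallBlocks B
    · rw [Set.indicator_of_mem hξ]
      refine le_trans ?_ (le_add_of_nonneg_left (Finset.sum_nonneg fun j _ => by positivity))
      have h3 : σ ^ 2 * ∑ i, ξ i ^ 2 = ∑ j, decSort (fun i => |σ * ξ i|) j ^ 2 := by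
        rw [sum_comp_decSort (fun i => |σ * ξ i|) (fun x => x ^ 2), Finset.mul_sum]
        exact Finset.sum_congr rfl fun i _ => by rw [sq_abs]; ring
      rw [h3]
      refine Finset.sum_le_sum fun j _ => ?_
      have h3 := decSort_abs_nonneg (fun i => σ * ξ i) j
      refine pow_le_pow_left₀ (le_max_right _ _) (max_le ?_ h3) 2
      have := mul_nonneg (Real.sqrt_nonneg x) (h0 j)
      linarith
    · rw [Set.indicator_of_notMem hξ, mul_zero, add_zero]
      refine Finset.sum_le_sum fun j _ => ?_
      have h3 : σ / 2 ≤ √x := Real.le_sqrt_of_sq_le (by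
        have := le_median hB hθ hs hx hξ; linarith [this, (by ring : (σ / 2) ^ 2 = σ ^ 2 / 4)])
      rw [← mul_pow, hz]
      refine pow_le_pow_left₀ (le_max_right _ _) (max_le ?_ (by positivity)) 2
      have h5 := mul_le_mul_of_nonneg_right h3 (h0 j)
      have h6 := mul_le_mul_of_nonneg_left
        (le_max_left (decSort (fun i => |ξ i|) j - lam j / 8) 0) hσ.le
      linarith
  have h4 : l2norm (fun i => h i - θ i) ^ 2 ≤ 8 * R ^ 2 + 8 * (x * D ^ 2) := by
    have h5 : (√x * D) ^ 2 = x * D ^ 2 := by rw [mul_pow, Real.sq_sqrt hx0]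
    rw [← h5]
    have := pow_le_pow_left₀ (l2norm_nonneg _) h1 2
    nlinarith [sq_nonneg (R - √x * D)]
  have h5 : D ^ 2 = ∑ j : Fin d, (if (j : ℕ) < s then lam j else 0) ^ 2 := l2norm_sq _
  rw [← h5]
  linarith

/-! ### Moments of the noise and sorted noise -/

lemma exists_rpow_le_exp_half {b : ℝ} (hb : 0 ≤ b) :
    ∃ C : ℝ, 0 < C ∧ ∀ x : ℝ, 0 ≤ x → x ^ b ≤ C * Real.exp (x / 2) := by
  refine ⟨2 ^ ⌈b⌉₊ * (⌈b⌉₊.factorial : ℝ), by positivity, fun x hx => ?_⟩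
  set n := ⌈b⌉₊
  have hC : (1 : ℝ) ≤ 2 ^ n * (n.factorial : ℝ) :=
    one_le_mul_of_one_le_of_one_le (one_le_pow₀ (by norm_num))
      (by exact_mod_cast Nat.factorial_pos n)
  rcases le_or_gt x 1 with h | h
  · exact (Real.rpow_le_one hx h hb).trans
      (one_le_mul_of_one_le_of_one_le hC (Real.one_le_exp (by positivity)))
  · have h1 : x ^ b ≤ x ^ n := by
      rw [← Real.rpow_natCast]
      exact Real.rpow_le_rpow_of_exponent_le h.le (Nat.le_ceil b)
    have h2 := Real.pow_div_factorial_le_exp (x / 2) (by positivity) n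
    rw [div_le_iff₀ (by positivity), div_pow, div_le_iff₀ (by positivity)] at h2
    calc x ^ b ≤ x ^ n := h1
      _ ≤ _ := h2
      _ = _ := by ring

lemma exists_log_rpow_le_sqrt {b : ℝ} (hb : 0 ≤ b) :
    ∃ C : ℝ, 0 < C ∧ ∀ x : ℝ, 1 ≤ x → Real.log x ^ b ≤ C * √x := by
  obtain ⟨C, hC, h⟩ := exists_rpow_le_exp_half hb
  refine ⟨C, hC, fun x hx => (h _ (Real.log_nonneg hx)).trans_eq ?_⟩
  rw [Real.sqrt_eq_rpow, Real.rpow_def_of_pos (by linarith)]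
  ring_nf

/-- An exponential transform of the noise. With the factor `1 / 4`, its square
`exp ((|x| / τ) ^ a / 2)` is integrable uniformly over the class of noise laws. -/
noncomputable def expMoment (a τ x : ℝ) : ℝ := Real.exp ((|x| / τ) ^ a / 4)

lemma one_le_expMoment {a τ : ℝ} (hτ : 0 < τ) (x : ℝ) : 1 ≤ expMoment a τ x :=
  Real.one_le_exp (by positivity)

lemma measurable_expMoment (a τ : ℝ) : Measurable (expMoment a τ) := by
  unfold expMoment; fun_prop

lemma expMoment_sq (a τ x : ℝ) : expMoment a τ x ^ 2 = Real.exp ((|x| / τ) ^ a / 2) := by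
  rw [expMoment, ← Real.exp_nat_mul]; congr 1; push_cast; ring

lemma prob_tail_le {a τ : ℝ} (ha : 0 < a) (hτ : 0 < τ) {P : Measure ℝ} (hP : P ∈ noiseClass a τ)
    {y : ℝ} (hy : (2 / τ) ^ a ≤ y) :
    P {x | y < (|x| / τ) ^ a} ≤ ENNReal.ofReal (2 * Real.exp (-y)) := by
  have := hP.1
  have hy0 : 0 ≤ y := le_trans (by positivity) hy
  have h1 : (2 : ℝ) ≤ τ * y ^ (1 / a) := by
    have := Real.rpow_le_rpow (by positivity) hy (by positivity : 0 ≤ 1 / a)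
    rw [← Real.rpow_mul (by positivity), mul_one_div_cancel ha.ne', Real.rpow_one,
      div_le_iff₀ hτ] at this
    linarith
  have h2 := hP.2.2.2.2 _ h1
  have h3 : (τ * y ^ (1 / a) / τ) ^ a = y := by
    rw [mul_div_cancel_left₀ _ hτ.ne', ← Real.rpow_mul hy0, one_div_mul_cancel ha.ne',
      Real.rpow_one]
  rw [h3] at h2
  rw [← ofReal_measureReal]
  refine ENNReal.ofReal_le_ofReal (le_trans (measureReal_mono fun x hx => ?_) h2)
  simp only [Set.mem_ofPred_eq] at hx ⊢
  have h4 := Real.rpow_lt_rpow hy0 hx (by positivity : 0 < 1 / a)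
  rw [← Real.rpow_mul (by positivity), mul_one_div_cancel ha.ne', Real.rpow_one,
    lt_div_iff₀ hτ] at h4
  linarith

/-- Uniform bound for the second moment of `expMoment`, by summing the tail bounds over unit
intervals of values of `(|x| / τ) ^ a`. -/
lemma exists_lintegral_exp_le {a τ : ℝ} (ha : 0 < a) (hτ : 0 < τ) :
    ∃ M : ℝ, 1 ≤ M ∧ ∀ P ∈ noiseClass a τ,
      ∫⁻ x, ENNReal.ofReal (expMoment a τ x ^ 2) ∂P ≤ ENNReal.ofReal M := by
  set N : ℕ := ⌈(2 / τ) ^ a⌉₊ with hN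
  set K : ℝ≥0∞ := ENNReal.ofReal (Real.exp (N / 2)) +
    ∑' n : ℕ, ENNReal.ofReal (2 * Real.exp (1 / 2) * Real.exp (-1 / 2) ^ n) with hK
  have hKtop : K ≠ ⊤ := by
    refine ENNReal.add_ne_top.mpr ⟨ENNReal.ofReal_ne_top, ?_⟩
    refine Summable.tsum_ofReal_ne_top (Summable.mul_left _ ?_)
    exact summable_geometric_of_lt_one (by positivity) (Real.exp_lt_one_iff.mpr (by norm_num))
  refine ⟨K.toReal + 1, by linarith [ENNReal.toReal_nonneg (a := K)], fun P hP => ?_⟩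
  have := hP.1
  have hpt : ∀ x : ℝ, ENNReal.ofReal (expMoment a τ x ^ 2) ≤ ENNReal.ofReal (Real.exp (N / 2)) +
      ∑' n : ℕ, {x : ℝ | ((n + N : ℕ) : ℝ) < (|x| / τ) ^ a}.indicator
        (fun _ => ENNReal.ofReal (Real.exp (((n + N : ℕ) + 1) / 2))) x := by
    intro x
    rw [expMoment_sq]
    have hX : 0 ≤ (|x| / τ) ^ a := by positivity
    set X := (|x| / τ) ^ a with hX'
    rcases le_or_gt X N with h | h
    · exact le_add_right (ENNReal.ofReal_le_ofReal (Real.exp_le_exp.mpr (by linarith)))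
    · refine le_add_left ?_
      -- the summand for which `X` lies in `(n + N, n + N + 1]` suffices
      have h1 : N + 1 ≤ ⌈X⌉₊ := Nat.lt_ceil.mpr h
      obtain ⟨n, hn⟩ := Nat.exists_eq_add_of_le h1
      refine le_trans ?_ (ENNReal.le_tsum n)
      have h2 : ((n + N : ℕ) : ℝ) < X := Nat.lt_ceil.mp (by omega)
      rw [Set.indicator_of_mem (by exact h2)]
      refine ENNReal.ofReal_le_ofReal (Real.exp_le_exp.mpr ?_)
      have h3 := Nat.le_ceil X
      rw [hn] at h3
      push_cast at h3 ⊢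
      linarith
  have hmeas : ∀ n : ℕ, MeasurableSet {x : ℝ | ((n + N : ℕ) : ℝ) < (|x| / τ) ^ a} := fun n =>
    measurableSet_lt measurable_const (by fun_prop)
  calc ∫⁻ x, ENNReal.ofReal (expMoment a τ x ^ 2) ∂P
      ≤ ∫⁻ x, (ENNReal.ofReal (Real.exp (N / 2)) +
      ∑' n : ℕ, {x : ℝ | ((n + N : ℕ) : ℝ) < (|x| / τ) ^ a}.indicator
        (fun _ => ENNReal.ofReal (Real.exp (((n + N : ℕ) + 1) / 2))) x) ∂P := lintegral_mono hpt
    _ = ENNReal.ofReal (Real.exp (N / 2)) + ∑' n : ℕ,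
          ENNReal.ofReal (Real.exp (((n + N : ℕ) + 1) / 2)) *
            P {x : ℝ | ((n + N : ℕ) : ℝ) < (|x| / τ) ^ a} := by
        rw [lintegral_add_left measurable_const, lintegral_const, measure_univ, mul_one,
          lintegral_tsum fun n => (measurable_const.indicator (hmeas n)).aemeasurable]
        congr 1
        exact tsum_congr fun n => lintegral_indicator_const (hmeas n) _
    _ ≤ K := by
        refine add_le_add le_rfl (ENNReal.tsum_le_tsum fun n => ?_)
        have hy : (2 / τ) ^ a ≤ ((n + N : ℕ) : ℝ) := (Nat.le_ceil _).trans (by push_cast; simp [hN])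
        refine (mul_le_mul_right (prob_tail_le ha hτ hP hy) _).trans ?_
        rw [← ENNReal.ofReal_mul (Real.exp_pos _).le]
        refine ENNReal.ofReal_le_ofReal ?_
        have e1 : Real.exp (((n + N : ℕ) + 1) / 2) * (2 * Real.exp (-((n + N : ℕ) : ℝ))) =
            2 * Real.exp (1 / 2) * Real.exp (-((n + N : ℕ) : ℝ) / 2) := by
          rw [mul_left_comm, ← Real.exp_add, mul_assoc, ← Real.exp_add]
          ring_nf
        rw [e1, ← Real.exp_nat_mul]
        refine mul_le_mul_of_nonneg_left (Real.exp_le_exp.mpr ?_) (by positivity)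
        push_cast
        have : (0 : ℝ) ≤ N := by positivity
        linarith
    _ ≤ ENNReal.ofReal (K.toReal + 1) := by
        rw [ENNReal.le_ofReal_iff_toReal_le hKtop (by positivity)]
        linarith

/-- Uniform moment bounds over the class of noise laws. -/
lemma exists_moment_bounds {a τ : ℝ} (ha : 0 < a) (hτ : 0 < τ) :
    ∃ M : ℝ, 1 ≤ M ∧ ∀ P ∈ noiseClass a τ,
      MemLp (expMoment a τ) 2 P ∧ ∫ x, expMoment a τ x ^ 2 ∂P ≤ M ∧
      Integrable (fun x => x ^ 4) P ∧ ∫ x, x ^ 4 ∂P ≤ M := by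
  obtain ⟨M, hM, h⟩ := exists_lintegral_exp_le ha hτ
  obtain ⟨C, hC, hC'⟩ := exists_rpow_le_exp_half (by positivity : 0 ≤ 4 / a)
  refine ⟨max M (τ ^ 4 * C * M), le_max_of_le_left hM, fun P hP => ?_⟩
  have hi : Integrable (fun x => expMoment a τ x ^ 2) P := by
    refine ⟨((measurable_expMoment a τ).pow_const 2).aestronglyMeasurable, ?_⟩
    rw [hasFiniteIntegral_iff_ofReal (ae_of_all _ fun x => by positivity)]
    exact (h P hP).trans_lt ENNReal.ofReal_lt_top
  have hle : ∫ x, expMoment a τ x ^ 2 ∂P ≤ M := by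
    rw [integral_eq_lintegral_of_nonneg_ae (ae_of_all _ fun x => by positivity) hi.1]
    exact ENNReal.toReal_le_of_le_ofReal (by linarith) (h P hP)
  have h4 : ∀ x : ℝ, x ^ 4 ≤ τ ^ 4 * C * expMoment a τ x ^ 2 := by
    intro x
    have e : x ^ 4 = τ ^ 4 * ((|x| / τ) ^ a) ^ (4 / a) := by
      rw [← Real.rpow_mul (by positivity), mul_div_cancel₀ _ ha.ne',
        show (4 : ℝ) = ((4 : ℕ) : ℝ) by norm_num, Real.rpow_natCast, div_pow,
        mul_div_cancel₀ _ (by positivity), ← abs_pow, abs_of_nonneg (by positivity)]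
    rw [e, expMoment_sq, mul_assoc]
    exact mul_le_mul_of_nonneg_left (hC' _ (by positivity)) (by positivity)
  have hi4 : Integrable (fun x : ℝ => x ^ 4) P := by
    refine (hi.const_mul (τ ^ 4 * C)).mono' (by fun_prop) (ae_of_all _ fun x => ?_)
    rw [Real.norm_of_nonneg (by positivity)]
    exact h4 x
  refine ⟨(memLp_two_iff_integrable_sq (measurable_expMoment a τ).aestronglyMeasurable).mpr hi,
    hle.trans (le_max_left _ _), hi4, le_max_of_le_right ?_⟩
  calc ∫ x, x ^ 4 ∂P ≤ ∫ x, τ ^ 4 * C * expMoment a τ x ^ 2 ∂P :=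
        integral_mono hi4 (hi.const_mul _) h4
    _ ≤ τ ^ 4 * C * M := by
        rw [integral_const_mul]
        exact mul_le_mul_of_nonneg_left hle (by positivity)

lemma one_le_log_exp_mul_div {d j : ℝ} (hj : 0 < j) (hjd : j ≤ d) :
    1 ≤ Real.log (Real.exp 1 * d / j) := by
  rw [Real.le_log_iff_exp_le (by have := hj.trans_le hjd; positivity), le_div_iff₀ hj]
  exact mul_le_mul_of_nonneg_left hjd (Real.exp_pos _).le

lemma log_exp_mul_div {d j : ℝ} (hj : 0 < j) (hd : 0 < d) :
    Real.log (Real.exp 1 * d / j) = 1 + Real.log (d / j) := by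
  rw [mul_div_assoc, Real.log_mul (Real.exp_pos _).ne' (by positivity), Real.log_exp]

lemma weight_nonneg {a c : ℝ} (hc : 0 ≤ c) {d : ℕ} (i : Fin d) : 0 ≤ weight a c d i := by
  have : ((i : ℕ) : ℝ) + 1 ≤ d := by exact_mod_cast i.2
  have := one_le_log_exp_mul_div (by positivity) this
  unfold weight
  positivity

lemma weight_antitone {a c : ℝ} (ha : 0 < a) (hc : 0 ≤ c) (d : ℕ) : Antitone (weight a c d) := by
  intro i j hij
  have hj : ((j : ℕ) : ℝ) + 1 ≤ d := by exact_mod_cast j.2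
  have h1 := one_le_log_exp_mul_div (by positivity) hj
  have hd : (0 : ℝ) < d := lt_of_lt_of_le (by positivity) hj
  have hij' : ((i : ℕ) : ℝ) ≤ (j : ℕ) := by exact_mod_cast hij
  refine mul_le_mul_of_nonneg_left (Real.rpow_le_rpow (by linarith) ?_ (by positivity)) hc
  exact Real.log_le_log (by positivity)
    (div_le_div_of_nonneg_left (by positivity) (by positivity) (by linarith))

/-- The sorted noise exceeds the weights `c log ^ (1 / a) (e d / j)` only as far as the empirical
mean of `expMoment` exceeds its expectation `e`: indeed the `j`-th largest noise `z` satisfies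
`j * expMoment z ≤ ∑ expMoment ξ_i`. -/
lemma exists_excess_le {a τ : ℝ} (ha : 0 < a) (hτ : 0 < τ) {M : ℝ} (hM : 1 ≤ M) :
    ∃ c C : ℝ, 0 < c ∧ 0 < C ∧ ∀ (d : ℕ) (ξ : Fin d → ℝ) (e : ℝ), 1 ≤ e → e ≤ M →
      ∑ j, max (decSort (fun i => |ξ i|) j - weight a c d j) 0 ^ 2 ≤
        C * ((∑ i, expMoment a τ (ξ i) - d * e) ^ 2 / d) := by
  obtain ⟨K, hK, hlog⟩ := exists_log_rpow_le_sqrt (by positivity : 0 ≤ 2 / a)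
  have hlM : 0 ≤ Real.log (2 * M) := Real.log_nonneg (by linarith)
  set κ : ℝ := τ * (8 * (1 + Real.log (2 * M))) ^ (1 / a) with hκ
  have hκ0 : 0 < κ := by positivity
  -- `κ` is large enough for both cases below: an empirical mean `W ≤ 2 M`, for which there is no
  -- excess, and `W > 2 M`, for which `W` is comparable to its fluctuation `W - e`
  refine ⟨κ, 4 * κ ^ 2 * K, hκ0, by positivity, fun d ξ e he heM => ?_⟩
  rcases Nat.eq_zero_or_pos d with rfl | hd
  · simp
  have hd' : (0 : ℝ) < d := by exact_mod_cast hd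
  set W : ℝ := (∑ i, expMoment a τ (ξ i)) / d with hW
  have hG : ∑ i, expMoment a τ (ξ i) = d * W := by rw [hW]; field_simp
  have hW1 : 1 ≤ W := by
    rw [hW, le_div_iff₀ hd', one_mul]
    calc (d : ℝ) = ∑ i : Fin d, (1 : ℝ) := by simp
      _ ≤ _ := Finset.sum_le_sum fun i _ => one_le_expMoment hτ _
  have hz : ∀ j : Fin d, decSort (fun i => |ξ i|) j ≤
      τ * (4 * (Real.log (Real.exp 1 * d / ((j : ℕ) + 1)) + Real.log W)) ^ (1 / a) := by
    intro j
    have hj0 : (0 : ℝ) < (j : ℕ) + 1 := by positivity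
    have hjd : ((j : ℕ) : ℝ) + 1 ≤ d := by exact_mod_cast j.2
    have h1 := card_mul_le_sum_of_decSort (fun i => |ξ i|) (g := expMoment a τ)
      (fun x => (Real.exp_pos _).le) (fun i i' h => by
        unfold expMoment
        simp only [abs_abs]
        gcongr) j
    have h2 : ∑ i, expMoment a τ |ξ i| = d * W := by
      rw [← hG]; simp [expMoment]
    rw [h2] at h1
    set z := decSort (fun i => |ξ i|) j with hzdef
    have hz0 : 0 ≤ z := decSort_abs_nonneg ξ j
    have h3 : expMoment a τ z ≤ d / ((j : ℕ) + 1) * W := by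
      rw [div_mul_eq_mul_div, le_div_iff₀ hj0]; linarith
    have h4 : (z / τ) ^ a / 4 ≤ Real.log (d / ((j : ℕ) + 1)) + Real.log W := by
      rw [← Real.log_mul (by positivity) (by positivity), Real.le_log_iff_exp_le (by positivity)]
      simpa [expMoment, abs_of_nonneg hz0] using h3
    have h5 := log_exp_mul_div hj0 hd'
    have h6 : (z / τ) ^ a ≤
        4 * (Real.log (Real.exp 1 * d / ((j : ℕ) + 1)) + Real.log W) := by linarith
    have h7 := Real.rpow_le_rpow (by positivity) h6 (by positivity : 0 ≤ 1 / a)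
    rw [← Real.rpow_mul (by positivity), mul_one_div_cancel ha.ne', Real.rpow_one,
      div_le_iff₀ hτ] at h7
    linarith
  rw [hG]
  rcases le_or_gt W (2 * M) with hWM | hWM
  · refine (Finset.sum_eq_zero fun j _ => ?_).trans_le (by positivity)
    have hjd : ((j : ℕ) : ℝ) + 1 ≤ d := by exact_mod_cast j.2
    have hL := one_le_log_exp_mul_div (by positivity) hjd
    have hlW : Real.log W ≤ Real.log (2 * M) := Real.log_le_log (by linarith) hWM
    have hlW0 := Real.log_nonneg hW1
    rw [max_eq_right, zero_pow two_ne_zero]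
    rw [sub_nonpos]
    refine (hz j).trans ?_
    unfold weight
    rw [hκ, mul_assoc, ← Real.mul_rpow (by positivity) (by positivity)]
    refine mul_le_mul_of_nonneg_left (Real.rpow_le_rpow (by positivity) ?_ (by positivity)) hτ.le
    nlinarith
  · have hlW0 := Real.log_nonneg hW1
    have hj : ∀ j : Fin d, max (decSort (fun i => |ξ i|) j - weight a κ d j) 0 ^ 2 ≤
        κ ^ 2 * (K * W ^ 2) := by
      intro j
      have hjd : ((j : ℕ) : ℝ) + 1 ≤ d := by exact_mod_cast j.2
      have hL := one_le_log_exp_mul_div (by positivity) hjd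
      set L := Real.log (Real.exp 1 * d / ((j : ℕ) + 1)) with hLdef
      have h1 : decSort (fun i => |ξ i|) j ≤ κ * (L ^ (1 / a) + Real.log W ^ (1 / a)) := by
        refine (hz j).trans ?_
        rw [hκ, mul_assoc]
        refine mul_le_mul_of_nonneg_left ?_ hτ.le
        have h2 : (4 * (L + Real.log W)) ^ (1 / a) ≤
            (8 * (1 + Real.log (2 * M)) * max L (Real.log W)) ^ (1 / a) := by
          refine Real.rpow_le_rpow (by positivity) ?_ (by positivity)
          have h3 := le_max_left L (Real.log W)
          have h4 := le_max_right L (Real.log W)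
          nlinarith
        refine h2.trans ?_
        rw [Real.mul_rpow (by positivity) (by positivity)]
        refine mul_le_mul_of_nonneg_left ?_ (by positivity)
        rcases max_cases L (Real.log W) with h | h <;> rw [h.1]
        · exact le_add_of_nonneg_right (by positivity)
        · exact le_add_of_nonneg_left (by positivity)
      have h2 : max (decSort (fun i => |ξ i|) j - weight a κ d j) 0 ≤
          κ * Real.log W ^ (1 / a) := by
        refine max_le ?_ (by positivity)
        unfold weight
        linarith
      refine (pow_le_pow_left₀ (le_max_right _ _) h2 2).trans ?_
      rw [mul_pow]
      refine mul_le_mul_of_nonneg_left ?_ (by positivity)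
      have h3 : (Real.log W ^ (1 / a)) ^ 2 = Real.log W ^ (2 / a) := by
        rw [← Real.rpow_natCast, ← Real.rpow_mul hlW0]; congr 1; push_cast; ring
      rw [h3]
      refine (hlog W hW1).trans (mul_le_mul_of_nonneg_left ?_ hK.le)
      exact (Real.sqrt_le_iff.mpr ⟨by linarith, by nlinarith⟩ : √W ≤ W).trans (by nlinarith)
    refine (Finset.sum_le_sum fun j _ => hj j).trans ?_
    rw [Finset.sum_const, Finset.card_univ, Fintype.card_fin, nsmul_eq_mul]
    have h1 : W ^ 2 ≤ 4 * (W - e) ^ 2 := by nlinarith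
    have h2 : (d * W - d * e) ^ 2 / d = d * (W - e) ^ 2 := by field_simp
    rw [h2]
    calc d * (κ ^ 2 * (K * W ^ 2)) ≤ d * (κ ^ 2 * (K * (4 * (W - e) ^ 2))) := by gcongr
      _ = _ := by ring

/-- The squares of the `s` largest weights sum to the order of `s` times the `s`-th one. -/
lemma exists_sum_weight_sq_le {a : ℝ} (ha : 0 < a) (c : ℝ) : ∃ C : ℝ, 0 < C ∧
    ∀ s d : ℕ, 1 ≤ s → s ≤ d →
      ∑ j : Fin d, (if (j : ℕ) < s then weight a c d j else 0) ^ 2 ≤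
        C * (s * Real.log (Real.exp 1 * d / s) ^ (2 / a)) := by
  obtain ⟨K, hK, hlog⟩ := exists_log_rpow_le_sqrt (by positivity : 0 ≤ 2 / a)
  refine ⟨c ^ 2 * (K * √(Real.exp 1) * 2) + 1, by positivity, fun s d hs hsd => ?_⟩
  have hs0 : (0 : ℝ) < s := by exact_mod_cast hs
  have hsd' : (s : ℝ) ≤ d := by exact_mod_cast hsd
  have hd0 : (0 : ℝ) < d := hs0.trans_le hsd'
  have hLs := one_le_log_exp_mul_div hs0 hsd'
  set Ls := Real.log (Real.exp 1 * d / s) with hLsdef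
  -- `log (e d / j) ≤ log (e d / s) * log (e s / j)`, and the power of the last factor is `O(√(s / j))`
  have h1 : ∀ j : ℕ, j < s →
      (c * Real.log (Real.exp 1 * d / ((j : ℝ) + 1)) ^ (1 / a)) ^ 2 ≤
        c ^ 2 * (Ls ^ (2 / a) * (K * √(Real.exp 1))) * (√s * (1 / √((j : ℝ) + 1))) := by
    intro j hj
    have hj0 : (0 : ℝ) < (j : ℝ) + 1 := by positivity
    have hjs : (j : ℝ) + 1 ≤ s := by exact_mod_cast hj
    have hL := one_le_log_exp_mul_div hj0 (hjs.trans hsd')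
    have h2 : Real.log (Real.exp 1 * d / ((j : ℝ) + 1)) ≤
        Ls * Real.log (Real.exp 1 * (s / ((j : ℝ) + 1))) := by
      rw [← mul_div_assoc, log_exp_mul_div hj0 hs0]
      have e1 : Real.log (Real.exp 1 * d / ((j : ℝ) + 1)) = Ls + Real.log (s / ((j : ℝ) + 1)) := by
        rw [hLsdef, ← Real.log_mul (by positivity) (by positivity)]
        congr 1
        field_simp
      have h3 : 0 ≤ Real.log (s / ((j : ℝ) + 1)) := Real.log_nonneg ((one_le_div hj0).mpr hjs)
      rw [e1]
      nlinarith
    have h4 : (1 : ℝ) ≤ Real.exp 1 * (s / ((j : ℝ) + 1)) :=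
      one_le_mul_of_one_le_of_one_le (Real.one_le_exp (by norm_num)) ((one_le_div hj0).mpr hjs)
    have h5 := hlog _ h4
    rw [Real.sqrt_mul (Real.exp_pos _).le, Real.sqrt_div hs0.le] at h5
    rw [mul_pow, mul_assoc]
    refine mul_le_mul_of_nonneg_left ?_ (sq_nonneg c)
    rw [← Real.rpow_natCast, ← Real.rpow_mul (by linarith),
      show 1 / a * ((2 : ℕ) : ℝ) = 2 / a by push_cast; ring]
    calc _ ≤ (Ls * Real.log (Real.exp 1 * (s / ((j : ℝ) + 1)))) ^ (2 / a) :=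
          Real.rpow_le_rpow (by linarith) h2 (by positivity)
      _ = Ls ^ (2 / a) * Real.log (Real.exp 1 * (s / ((j : ℝ) + 1))) ^ (2 / a) :=
          Real.mul_rpow (by linarith) (Real.log_nonneg h4)
      _ ≤ Ls ^ (2 / a) * (K * (√(Real.exp 1) * (√s / √((j : ℝ) + 1)))) :=
          mul_le_mul_of_nonneg_left h5 (by positivity)
      _ = _ := by ring
  have h2 : ∀ n : ℕ, ∑ j ∈ Finset.range n, 1 / √((j : ℝ) + 1) ≤ 2 * √n := by
    intro n
    induction n with
    | zero => simp
    | succ n ih =>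
      rw [Finset.sum_range_succ]
      push_cast
      have h3 : 0 < √((n : ℝ) + 1) := Real.sqrt_pos.mpr (by positivity)
      have h4 := Real.sq_sqrt (by positivity : (0 : ℝ) ≤ (n : ℝ) + 1)
      have h5 := Real.sq_sqrt (by positivity : (0 : ℝ) ≤ (n : ℝ))
      have h6 := Real.sqrt_nonneg (n : ℝ)
      have h7 : 1 / √((n : ℝ) + 1) ≤ 2 * √((n : ℝ) + 1) - 2 * √n := by
        rw [div_le_iff₀ h3]
        nlinarith [sq_nonneg (√((n : ℝ) + 1) - √n)]
      linarith
  calc ∑ j : Fin d, (if (j : ℕ) < s then weight a c d j else 0) ^ 2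
      = ∑ j ∈ Finset.range d, (if j < s then
          c * Real.log (Real.exp 1 * d / ((j : ℝ) + 1)) ^ (1 / a) else 0) ^ 2 :=
        Fin.sum_univ_eq_sum_range (fun j => (if j < s then
          c * Real.log (Real.exp 1 * d / ((j : ℝ) + 1)) ^ (1 / a) else 0) ^ 2) d
    _ = ∑ j ∈ Finset.range s, (c * Real.log (Real.exp 1 * d / ((j : ℝ) + 1)) ^ (1 / a)) ^ 2 := by
        symm
        refine Finset.sum_subset_zero_on_sdiff (Finset.range_subset_range.mpr hsd) ?_ ?_
        · intro j hj
          rw [if_neg (by simpa using (Finset.mem_sdiff.mp hj).2), zero_pow two_ne_zero]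
        · intro j hj
          rw [if_pos (Finset.mem_range.mp hj)]
    _ ≤ ∑ j ∈ Finset.range s,
          c ^ 2 * (Ls ^ (2 / a) * (K * √(Real.exp 1))) * (√s * (1 / √((j : ℝ) + 1))) :=
        Finset.sum_le_sum fun j hj => h1 j (Finset.mem_range.mp hj)
    _ ≤ c ^ 2 * (Ls ^ (2 / a) * (K * √(Real.exp 1))) * (√s * (2 * √s)) := by
        rw [← Finset.mul_sum, ← Finset.mul_sum]
        gcongr
        exact h2 s
    _ = c ^ 2 * (K * √(Real.exp 1) * 2) * (s * Ls ^ (2 / a)) := by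
        rw [show √s * (2 * √s) = 2 * (√s * √s) by ring, Real.mul_self_sqrt hs0.le]; ring
    _ ≤ _ := mul_le_mul_of_nonneg_right (by linarith) (by positivity)

/-! ### Averages over independent coordinates and the rate -/

lemma integral_sum_sub_sq_le {d : ℕ} {X : Type*} [MeasurableSpace X] {P : Measure X}
    [IsProbabilityMeasure P] {f : Fin d → X → ℝ} (hf : ∀ i, MemLp (f i) 2 P) :
    Integrable (fun ξ : Fin d → X => (∑ i, f i (ξ i) - ∑ i, ∫ x, f i x ∂P) ^ 2)
        (Measure.pi fun _ => P) ∧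
      ∫ ξ : Fin d → X, (∑ i, f i (ξ i) - ∑ i, ∫ x, f i x ∂P) ^ 2 ∂(Measure.pi fun _ => P) ≤
        ∑ i, ∫ x, f i x ^ 2 ∂P := by
  have hmem : ∀ i, MemLp (fun ξ : Fin d → X => f i (ξ i)) 2 (Measure.pi fun _ => P) := fun i =>
    (hf i).comp_measurePreserving (measurePreserving_eval (fun _ => P) i)
  have hsum : MemLp (fun ξ : Fin d → X => ∑ i, f i (ξ i)) 2 (Measure.pi fun _ => P) :=
    memLp_finsetSum _ fun i _ => hmem i
  have hint : ∫ ξ : Fin d → X, ∑ i, f i (ξ i) ∂(Measure.pi fun _ => P) = ∑ i, ∫ x, f i x ∂P := by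
    rw [integral_finsetSum _ fun i _ => (hmem i).integrable one_le_two]
    exact Finset.sum_congr rfl fun i _ => integral_comp_eval (μ := fun _ => P) (hf i).1
  have hvar := ProbabilityTheory.variance_sum_pi (μ := fun _ : Fin d => P) hf
  have hfun : (∑ i, fun ξ : Fin d → X => f i (ξ i)) = fun ξ => ∑ i, f i (ξ i) := by
    ext ξ; simp
  rw [hfun, ProbabilityTheory.variance_eq_integral hsum.1.aemeasurable, hint] at hvar
  refine ⟨(hsum.sub (memLp_const _)).integrable_sq, hvar.trans_le ?_⟩
  exact Finset.sum_le_sum fun i _ => ProbabilityTheory.variance_le_expectation_sq (hf i).1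

/-- A sum of exponentials dominating the indicator of `smallBlocks B`: one term for every
collection of at least a quarter of the blocks, which is a product over the coordinates. -/
noncomputable def smallBlocksBound {d m : ℕ} (B : Fin m → Finset (Fin d)) (M : ℝ)
    (ξ : Fin d → ℝ) : ℝ :=
  ∑ S ∈ (Finset.univ : Finset (Finset (Fin m))).filter (fun S => m ≤ 4 * S.card),
    ∏ j, if j ∈ S.biUnion B then Real.exp ((1 / 4 - ξ j ^ 2) / M) else 1

lemma smallBlocksBound_nonneg {d m : ℕ} (B : Fin m → Finset (Fin d)) (M : ℝ)
    (ξ : Fin d → ℝ) : 0 ≤ smallBlocksBound B M ξ :=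
  Finset.sum_nonneg fun S _ => Finset.prod_nonneg fun j _ => by split_ifs <;> positivity

lemma one_le_smallBlocksBound {d m : ℕ} {B : Fin m → Finset (Fin d)} (hB : IsBlockPartition B)
    {M : ℝ} (hM : 0 < M) {ξ : Fin d → ℝ} (hξ : ξ ∈ smallBlocks B) :
    1 ≤ smallBlocksBound B M ξ := by
  set S := Finset.univ.filter fun i => blockMean B ξ i < 1 / 4 with hS
  have hmem : S ∈ (Finset.univ : Finset (Finset (Fin m))).filter (fun S => m ≤ 4 * S.card) := by
    exact Finset.mem_filter.mpr ⟨Finset.mem_univ _, hξ⟩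
  refine le_trans ?_ (Finset.single_le_sum (f := fun S : Finset (Fin m) =>
    ∏ j, if j ∈ S.biUnion B then Real.exp ((1 / 4 - ξ j ^ 2) / M) else 1)
    (fun S _ => Finset.prod_nonneg fun j _ => by split_ifs <;> positivity) hmem)
  rw [Finset.prod_ite_mem, Finset.univ_inter, ← Real.exp_sum]
  refine Real.one_le_exp ?_
  rw [Finset.sum_biUnion fun i _ j _ hij => hB.1 hij]
  refine Finset.sum_nonneg fun i hi => ?_
  rw [← Finset.sum_div, Finset.sum_sub_distrib, Finset.sum_const, nsmul_eq_mul]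
  refine div_nonneg ?_ hM.le
  have h1 : blockMean B ξ i < 1 / 4 := by simpa [hS] using hi
  unfold blockMean at h1
  rcases Nat.eq_zero_or_pos (B i).card with h | h
  · rw [Finset.card_eq_zero] at h
    simp [h]
  · rw [div_lt_iff₀ (by exact_mod_cast h)] at h1
    linarith

/-- The fourth moment controls the lower tail of the squared noise, through
`exp (-y) ≤ 1 - y + y ^ 2 / 2`. -/
lemma integral_exp_sub_sq_le {P : Measure ℝ} [IsProbabilityMeasure P] {M : ℝ} (hM : 1 ≤ M)
    (h2 : MemLp (fun x : ℝ => x) 2 P) (hv : ∫ x, x ^ 2 ∂P = 1)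
    (hi4 : Integrable (fun x : ℝ => x ^ 4) P) (h4 : ∫ x, x ^ 4 ∂P ≤ M) :
    Integrable (fun x : ℝ => Real.exp ((1 / 4 - x ^ 2) / M)) P ∧
      ∫ x, Real.exp ((1 / 4 - x ^ 2) / M) ∂P ≤ Real.exp (-1 / (4 * M)) := by
  have hM0 : 0 < M := by linarith
  have hi2 : Integrable (fun x : ℝ => x ^ 2) P := h2.integrable_sq
  have hi : Integrable (fun x : ℝ => Real.exp ((1 / 4 - x ^ 2) / M)) P := by
    refine Integrable.of_bound (by fun_prop) (Real.exp (1 / (4 * M))) (ae_of_all _ fun x => ?_)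
    rw [Real.norm_of_nonneg (Real.exp_pos _).le, Real.exp_le_exp, div_le_div_iff₀ hM0 (by positivity)]
    nlinarith [sq_nonneg x]
  refine ⟨hi, ?_⟩
  have hpt : ∀ x : ℝ, Real.exp ((1 / 4 - x ^ 2) / M) ≤
      Real.exp (1 / (4 * M)) * (1 - x ^ 2 / M + x ^ 4 / (2 * M ^ 2)) := by
    intro x
    have e1 : (1 / 4 - x ^ 2) / M = 1 / (4 * M) + -(x ^ 2 / M) := by field_simp; ring
    rw [e1, Real.exp_add]
    refine mul_le_mul_of_nonneg_left ?_ (Real.exp_pos _).le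
    have h := Real.quadratic_le_exp_of_nonneg (by positivity : 0 ≤ x ^ 2 / M)
    have e2 : x ^ 4 / (2 * M ^ 2) = (x ^ 2 / M) ^ 2 / 2 := by field_simp
    rw [e2, Real.exp_neg]
    have hy : 0 ≤ x ^ 2 / M := by positivity
    set y := x ^ 2 / M
    rw [inv_le_iff_one_le_mul₀ (Real.exp_pos _)]
    have h3 : 0 ≤ 1 - y + y ^ 2 / 2 := by nlinarith [sq_nonneg (y - 1)]
    calc (1 : ℝ) ≤ (1 - y + y ^ 2 / 2) * (1 + y + y ^ 2 / 2) := by nlinarith [sq_nonneg (y ^ 2)]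
      _ ≤ _ := mul_le_mul_of_nonneg_left h h3
  have hia : Integrable (fun x : ℝ => 1 - x ^ 2 / M) P :=
    (integrable_const 1).sub (hi2.div_const M)
  have hib : Integrable (fun x : ℝ => 1 - x ^ 2 / M + x ^ 4 / (2 * M ^ 2)) P :=
    hia.add (hi4.div_const _)
  have hval : ∫ x, (1 - x ^ 2 / M + x ^ 4 / (2 * M ^ 2)) ∂P ≤ 1 - 1 / (2 * M) := by
    rw [integral_add hia (hi4.div_const _),
      integral_sub (integrable_const 1) (hi2.div_const M), integral_div, integral_div, hv]
    simp only [integral_const, probReal_univ, smul_eq_mul, one_mul]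
    have h5 : (∫ x, x ^ 4 ∂P) / (2 * M ^ 2) ≤ M / (2 * M ^ 2) :=
      div_le_div_of_nonneg_right h4 (by positivity)
    have e3 : M / (2 * M ^ 2) = 1 / (2 * M) := by field_simp
    have e4 : 1 / M = 1 / (2 * M) + 1 / (2 * M) := by field_simp; norm_num
    linarith
  calc ∫ x, Real.exp ((1 / 4 - x ^ 2) / M) ∂P
      ≤ ∫ x, Real.exp (1 / (4 * M)) * (1 - x ^ 2 / M + x ^ 4 / (2 * M ^ 2)) ∂P :=
        integral_mono hi (hib.const_mul _) hpt
    _ ≤ Real.exp (1 / (4 * M)) * Real.exp (-(1 / (2 * M))) := by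
        rw [integral_const_mul]
        refine mul_le_mul_of_nonneg_left (hval.trans ?_) (Real.exp_pos _).le
        have := Real.add_one_le_exp (-(1 / (2 * M)))
        linarith
    _ = Real.exp (-1 / (4 * M)) := by
        rw [← Real.exp_add]; congr 1; field_simp; norm_num

/-- The union bound over collections of blocks: blocks of at least `48 M` independent coordinates
make every term of `smallBlocksBound` at most `8 ^ (-m)` in expectation. -/
lemma integral_smallBlocksBound_le {d m : ℕ} {B : Fin m → Finset (Fin d)}
    (hB : IsBlockPartition B) {P : Measure ℝ} [IsProbabilityMeasure P] {M : ℝ} (hM : 1 ≤ M)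
    (h2 : MemLp (fun x : ℝ => x) 2 P) (hv : ∫ x, x ^ 2 ∂P = 1)
    (hi4 : Integrable (fun x : ℝ => x ^ 4) P) (h4 : ∫ x, x ^ 4 ∂P ≤ M)
    (hcard : ∀ i, 48 * M ≤ (B i).card) :
    Integrable (smallBlocksBound B M) (Measure.pi fun _ => P) ∧
      ∫ ξ, smallBlocksBound B M ξ ∂(Measure.pi fun _ => P) ≤ (1 / 4) ^ m := by
  obtain ⟨hi, hρ⟩ := integral_exp_sub_sq_le hM h2 hv hi4 h4
  have hterm : ∀ S : Finset (Fin m), Integrable (fun ξ : Fin d → ℝ =>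
      ∏ j, if j ∈ S.biUnion B then Real.exp ((1 / 4 - ξ j ^ 2) / M) else 1)
      (Measure.pi fun _ => P) := by
    intro S
    refine Integrable.fintype_prod (f := fun j (x : ℝ) =>
      if j ∈ S.biUnion B then Real.exp ((1 / 4 - x ^ 2) / M) else 1) (μ := fun _ => P) fun j => ?_
    by_cases h : j ∈ S.biUnion B
    · simpa only [h, if_true] using hi
    · simpa only [h, if_false] using integrable_const 1
  refine ⟨integrable_finsetSum _ fun S _ => hterm S, ?_⟩
  unfold smallBlocksBound
  rw [integral_finsetSum _ fun S _ => hterm S]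
  have hle : ∀ S ∈ (Finset.univ : Finset (Finset (Fin m))).filter (fun S => m ≤ 4 * S.card),
      ∫ ξ : Fin d → ℝ, ∏ j, (if j ∈ S.biUnion B then Real.exp ((1 / 4 - ξ j ^ 2) / M) else 1)
        ∂(Measure.pi fun _ => P) ≤ (1 / 8) ^ m := by
    intro S hS
    have hS' : m ≤ 4 * S.card := (Finset.mem_filter.mp hS).2
    rw [integral_fintype_prod_eq_prod (fun j (x : ℝ) =>
      if j ∈ S.biUnion B then Real.exp ((1 / 4 - x ^ 2) / M) else 1)]
    have e1 : ∀ j, ∫ x, (if j ∈ S.biUnion B then Real.exp ((1 / 4 - x ^ 2) / M) else 1) ∂P =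
        if j ∈ S.biUnion B then ∫ x, Real.exp ((1 / 4 - x ^ 2) / M) ∂P else 1 := by
      intro j
      split_ifs <;> simp
    rw [Finset.prod_congr rfl fun j _ => e1 j, Finset.prod_ite_mem, Finset.univ_inter,
      Finset.prod_const]
    have hU : 12 * M * m ≤ ((S.biUnion B).card : ℝ) := by
      rw [Finset.card_biUnion fun i _ j _ hij => hB.1 hij]
      push_cast
      have h5 : S.card • (48 * M) ≤ ∑ i ∈ S, ((B i).card : ℝ) :=
        Finset.card_nsmul_le_sum _ _ _ fun i _ => hcard i
      have h6 : (m : ℝ) ≤ 4 * S.card := by exact_mod_cast hS'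
      rw [nsmul_eq_mul] at h5
      nlinarith
    calc (∫ x, Real.exp ((1 / 4 - x ^ 2) / M) ∂P) ^ (S.biUnion B).card
        ≤ Real.exp (-1 / (4 * M)) ^ (S.biUnion B).card :=
          pow_le_pow_left₀ (integral_nonneg fun x => (Real.exp_pos _).le) hρ _
      _ = Real.exp ((S.biUnion B).card * (-1 / (4 * M))) := (Real.exp_nat_mul _ _).symm
      _ ≤ Real.exp (m * (-3)) := by
          rw [Real.exp_le_exp]
          have hM0 : 0 < M := by linarith
          have e2 : (12 * M * m) * (-1 / (4 * M)) = m * (-3) := by field_simp; ring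
          rw [← e2]
          refine mul_le_mul_of_nonpos_right hU ?_
          exact div_nonpos_of_nonpos_of_nonneg (by norm_num) (by positivity)
      _ = Real.exp (-3) ^ m := Real.exp_nat_mul _ _
      _ ≤ (1 / 8) ^ m := by
          refine pow_le_pow_left₀ (Real.exp_pos _).le ?_ _
          rw [Real.exp_neg, inv_eq_one_div]
          refine one_div_le_one_div_of_le (by norm_num) ?_
          have h7 := Real.add_one_le_exp (1 : ℝ)
          have h8 : Real.exp 3 = Real.exp 1 ^ 3 := by rw [← Real.exp_nat_mul]; norm_num
          rw [h8]
          calc (8 : ℝ) = 2 ^ 3 := by norm_num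
            _ ≤ _ := pow_le_pow_left₀ (by norm_num) (by linarith) 3
  refine (Finset.sum_le_card_nsmul _ _ _ hle).trans ?_
  rw [nsmul_eq_mul]
  have hc : (((Finset.univ : Finset (Finset (Fin m))).filter
      (fun S => m ≤ 4 * S.card)).card : ℝ) ≤ 2 ^ m := by
    have := Finset.card_filter_le (Finset.univ : Finset (Finset (Fin m))) (fun S => m ≤ 4 * S.card)
    rw [Finset.card_univ, Fintype.card_finset, Fintype.card_fin] at this
    exact_mod_cast this
  refine (mul_le_mul_of_nonneg_right hc (by positivity)).trans_eq ?_
  rw [← mul_pow]; norm_num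

/-- The weight `d ^ 2` on the rare event is affordable because its probability is exponentially
small in `d`. -/
lemma indicator_smallBlocks_le {d m : ℕ} (hd : 0 < d) {B : Fin m → Finset (Fin d)}
    (hB : IsBlockPartition B) {M : ℝ} (hM : 0 < M) (ξ : Fin d → ℝ) :
    (smallBlocks B).indicator (fun ξ => ∑ i, ξ i ^ 2) ξ ≤
      (∑ i, ξ i ^ 4) / d + (d : ℝ) ^ 2 * smallBlocksBound B M ξ := by
  have hd' : (0 : ℝ) < d := by exact_mod_cast hd
  have hb := smallBlocksBound_nonneg B M ξ
  have h4 : 0 ≤ (∑ i, ξ i ^ 4) / d :=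
    div_nonneg (Finset.sum_nonneg fun i _ => by positivity) hd'.le
  by_cases hξ : ξ ∈ smallBlocks B
  · rw [Set.indicator_of_mem hξ]
    have h1 := one_le_smallBlocksBound hB hM hξ
    have h2 : (∑ i, ξ i ^ 2) ^ 2 ≤ d * ∑ i, ξ i ^ 4 := by
      have := sq_sum_le_card_mul_sum_sq (s := (Finset.univ : Finset (Fin d)))
        (f := fun i => ξ i ^ 2)
      simpa [← pow_mul] using this
    have h3 : ((∑ i, ξ i ^ 2) / d) ^ 2 ≤ (∑ i, ξ i ^ 4) / d := by
      rw [div_pow, div_le_div_iff₀ (by positivity) hd']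
      nlinarith
    have h5 : ∑ i, ξ i ^ 2 = (∑ i, ξ i ^ 2) / d * d := by field_simp
    have h6 : (d : ℝ) ^ 2 * 1 ≤ (d : ℝ) ^ 2 * smallBlocksBound B M ξ :=
      mul_le_mul_of_nonneg_left h1 (by positivity)
    rw [h5]
    nlinarith [sq_nonneg ((∑ i, ξ i ^ 2) / d - d), sq_nonneg ((∑ i, ξ i ^ 2) / d), sq_nonneg (d : ℝ)]
  · rw [Set.indicator_of_notMem hξ]
    positivity

lemma integral_sum_blockMean {d m : ℕ} {B : Fin m → Finset (Fin d)} {P : Measure ℝ}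
    [IsProbabilityMeasure P] (h2 : MemLp (fun x : ℝ => x) 2 P) (hv : ∫ x, x ^ 2 ∂P = 1) :
    Integrable (fun ξ => ∑ i, blockMean B ξ i) (Measure.pi fun _ : Fin d => P) ∧
      ∫ ξ, ∑ i, blockMean B ξ i ∂(Measure.pi fun _ : Fin d => P) ≤ m := by
  have hi : ∀ j : Fin d, Integrable (fun ξ : Fin d → ℝ => ξ j ^ 2) (Measure.pi fun _ => P) :=
    fun j => integrable_comp_eval (μ := fun _ => P) h2.integrable_sq
  have hb : ∀ i, Integrable (fun ξ => blockMean B ξ i) (Measure.pi fun _ : Fin d => P) := fun i =>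
    (integrable_finsetSum _ fun j _ => hi j).div_const _
  refine ⟨integrable_finsetSum _ fun i _ => hb i, ?_⟩
  rw [integral_finsetSum _ fun i _ => hb i]
  refine (Finset.sum_le_card_nsmul _ _ 1 fun i _ => ?_).trans_eq (by simp)
  unfold blockMean
  rw [integral_div, integral_finsetSum _ fun j _ => hi j,
    Finset.sum_congr rfl fun j _ => (integral_comp_eval (μ := fun _ : Fin d => P) (i := j)
      (f := fun x => x ^ 2) h2.integrable_sq.1).trans hv]
  simp only [Finset.sum_const, nsmul_eq_mul, mul_one]
  exact div_self_le_one _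

lemma rate_sq {a : ℝ} {s d : ℕ} (hs : 1 ≤ s) (hsd : s ≤ d) :
    rate a s d ^ 2 = min (s * Real.log (Real.exp 1 * d / s) ^ (2 / a)) √d := by
  have hL := one_le_log_exp_mul_div (j := s) (d := d) (by exact_mod_cast hs) (by exact_mod_cast hsd)
  have e1 : (√(s : ℝ) * Real.log (Real.exp 1 * d / s) ^ (1 / a)) ^ 2 =
      s * Real.log (Real.exp 1 * d / s) ^ (2 / a) := by
    rw [mul_pow, Real.sq_sqrt (by positivity), ← Real.rpow_natCast (_ ^ _),
      ← Real.rpow_mul (by linarith)]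
    congr 2; push_cast; ring
  have e2 : ((d : ℝ) ^ (1 / 4 : ℝ)) ^ 2 = √d := by
    rw [Real.sqrt_eq_rpow, ← Real.rpow_natCast (_ ^ _), ← Real.rpow_mul (by positivity)]
    norm_num
  rw [← e1, ← e2]
  have h1 : 0 ≤ √(s : ℝ) * Real.log (Real.exp 1 * d / s) ^ (1 / a) := by positivity
  have h2 : 0 ≤ (d : ℝ) ^ (1 / 4 : ℝ) := by positivity
  unfold rate
  rcases le_total (√(s : ℝ) * Real.log (Real.exp 1 * d / s) ^ (1 / a)) ((d : ℝ) ^ (1 / 4 : ℝ))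
    with h | h
  · rw [min_eq_left h, min_eq_left (pow_le_pow_left₀ h1 h 2)]
  · rw [min_eq_right h, min_eq_right (pow_le_pow_left₀ h2 h 2)]

lemma rate_pos {a : ℝ} {s d : ℕ} (hs : 1 ≤ s) (hsd : s ≤ d) : 0 < rate a s d := by
  have hL := one_le_log_exp_mul_div (j := s) (d := d) (by exact_mod_cast hs) (by exact_mod_cast hsd)
  have h1 : (0 : ℝ) < s := by exact_mod_cast hs
  have h2 : (0 : ℝ) < d := h1.trans_le (by exact_mod_cast hsd)
  exact lt_min (mul_pos (Real.sqrt_pos.mpr h1) (Real.rpow_pos_of_pos (by linarith) _))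
    (Real.rpow_pos_of_pos h2 _)

lemma rate_sq_of_sparse_zone {a : ℝ} (ha : 0 < a) {s d : ℕ} (hs : 1 ≤ s) (hsd : s ≤ d)
    (h : (s : ℝ) ≤ √d / Real.log (Real.exp 1 * d) ^ (2 / a)) :
    rate a s d ^ 2 = s * Real.log (Real.exp 1 * d / s) ^ (2 / a) := by
  rw [rate_sq hs hsd, min_eq_left]
  have hs1 : (1 : ℝ) ≤ s := by exact_mod_cast hs
  have hsd' : (s : ℝ) ≤ d := by exact_mod_cast hsd
  have hL := one_le_log_exp_mul_div (by linarith) hsd'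
  have hd := one_le_log_exp_mul_div one_pos (hs1.trans hsd')
  rw [div_one] at hd
  rw [le_div_iff₀ (Real.rpow_pos_of_pos (by linarith) _)] at h
  refine le_trans (mul_le_mul_of_nonneg_left
    (Real.rpow_le_rpow (by linarith) ?_ (by positivity)) (by positivity)) h
  have hd0 : (0 : ℝ) < d := by linarith
  exact Real.log_le_log (by positivity) (div_le_self (by positivity) hs1)

lemma sqrt_le_rate_sq_of_dense_zone {a : ℝ} (ha : 0 < a) {s d : ℕ} (hs : 1 ≤ s) (hsd : s ≤ d)
    (h : ¬ (s : ℝ) ≤ √d / Real.log (Real.exp 1 * d) ^ (2 / a)) :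
    √d ≤ 2 ^ (2 / a) * rate a s d ^ 2 := by
  have h2 : (1 : ℝ) ≤ 2 ^ (2 / a) := Real.one_le_rpow (by norm_num) (by positivity)
  rw [rate_sq hs hsd]
  have hs1 : (1 : ℝ) ≤ s := by exact_mod_cast hs
  have hsd' : (s : ℝ) ≤ d := by exact_mod_cast hsd
  have hL := one_le_log_exp_mul_div (by linarith) hsd'
  have hd := one_le_log_exp_mul_div one_pos (hs1.trans hsd')
  rw [div_one] at hd
  rw [mul_min_of_nonneg _ _ (by positivity), le_min_iff]
  refine ⟨?_, le_mul_of_one_le_left (by positivity) h2⟩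
  rcases le_or_gt √(d : ℝ) s with hsq | hsq
  · have : (1 : ℝ) ≤ Real.log (Real.exp 1 * d / s) ^ (2 / a) :=
      Real.one_le_rpow hL (by positivity)
    calc √(d : ℝ) ≤ s := hsq
      _ ≤ 2 ^ (2 / a) * (s * Real.log (Real.exp 1 * d / s) ^ (2 / a)) :=
        (le_mul_of_one_le_right (by linarith) this).trans (le_mul_of_one_le_left (by positivity) h2)
  · rw [not_le, div_lt_iff₀ (by positivity)] at h
    refine h.le.trans ?_
    rw [mul_left_comm, ← Real.mul_rpow (by norm_num) (by linarith)]
    refine mul_le_mul_of_nonneg_left (Real.rpow_le_rpow (by linarith) ?_ (by positivity))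
      (by linarith)
    have hd0 : (0 : ℝ) < d := by linarith
    have hdd : √(d : ℝ) * √d = d := Real.mul_self_sqrt hd0.le
    have h3 : Real.log √d ≤ Real.log (d / s) := by
      refine Real.log_le_log (Real.sqrt_pos.mpr hd0) ?_
      rw [le_div_iff₀ (by linarith)]
      nlinarith [Real.sqrt_nonneg (d : ℝ)]
    rw [Real.log_sqrt hd0.le] at h3
    rw [log_exp_mul_div (by linarith) hd0, Real.log_mul (Real.exp_pos _).ne' hd0.ne', Real.log_exp]
    linarith

/-- Pointwise error bound in the dense zone. When the cross term `A`, typically of order `n`,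
dominates `B`, the error is at most `2 |A| / n`, so that it does not grow with `n`; otherwise the
squared error is at most `2 |B|`. -/
lemma sq_sqrt_abs_sub_le {n A B : ℝ} (hn : 0 ≤ n) (hA : n = 0 → A = 0) :
    (√|n ^ 2 + A + B| - n) ^ 2 ≤ 2 * |B| + 4 * (A ^ 2 / n ^ 2) := by
  set r := √|n ^ 2 + A + B| with hr
  have hr0 : 0 ≤ r := Real.sqrt_nonneg _
  have hr2 : r ^ 2 = |n ^ 2 + A + B| := Real.sq_sqrt (abs_nonneg _)
  have h1 : |r - n| * (r + n) ≤ |A| + |B| := by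
    have e1 : |r - n| * (r + n) = |r ^ 2 - n ^ 2| := by
      rw [show r ^ 2 - n ^ 2 = (r - n) * (r + n) by ring, abs_mul, abs_of_nonneg (add_nonneg hr0 hn)]
    rw [e1, hr2]
    calc |(|n ^ 2 + A + B|) - n ^ 2| = |(|n ^ 2 + A + B|) - (|n ^ 2|)| := by
          rw [abs_of_nonneg (sq_nonneg n)]
      _ ≤ |n ^ 2 + A + B - n ^ 2| := abs_abs_sub_abs_le_abs_sub _ _
      _ = |A + B| := by congr 1; ring
      _ ≤ _ := abs_add_le _ _
  have h2 : |r - n| ≤ r + n := by rw [abs_le]; constructor <;> linarith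
  have h3 : n ≤ r + n := by linarith
  have hx := abs_nonneg (r - n)
  have hAB : 0 ≤ A ^ 2 / n ^ 2 := by positivity
  rw [← sq_abs (r - n)]
  rcases le_total |A| |B| with h | h
  · nlinarith
  · rcases hn.eq_or_lt with h0 | h0
    · rw [hA h0.symm, abs_zero] at h
      rw [hA h0.symm, abs_zero] at h1
      nlinarith
    · have h4 : |r - n| * n ≤ 2 * |A| := by nlinarith
      have h5 : |r - n| ≤ 2 * |A| / n := by rwa [le_div_iff₀ h0]
      have h6 := pow_le_pow_left₀ hx h5 2
      have e2 : (2 * |A| / n) ^ 2 = 4 * (A ^ 2 / n ^ 2) := by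
        rw [div_pow, mul_pow, sq_abs]; ring
      have := abs_nonneg B
      linarith

/-! ### The risk of the estimator -/

lemma lintegral_law_le {d : ℕ} {θ : Fin d → ℝ} {P : Measure ℝ} {σ : ℝ} {f F : (Fin d → ℝ) → ℝ}
    {C : ℝ} (hpt : ∀ ξ, f (fun i => θ i + σ * ξ i) ≤ F ξ) (hF0 : ∀ ξ, 0 ≤ F ξ)
    (hF : Integrable F (Measure.pi fun _ => P)) (hC : ∫ ξ, F ξ ∂(Measure.pi fun _ => P) ≤ C) :
    ∫⁻ y, ENNReal.ofReal (f y) ∂(law θ P σ) ≤ ENNReal.ofReal C :=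
  calc ∫⁻ y, ENNReal.ofReal (f y) ∂(law θ P σ)
      ≤ ∫⁻ ξ, ENNReal.ofReal (f fun i => θ i + σ * ξ i) ∂(Measure.pi fun _ => P) :=
        lintegral_map_le _ _
    _ ≤ ∫⁻ ξ, ENNReal.ofReal (F ξ) ∂(Measure.pi fun _ => P) :=
        lintegral_mono fun ξ => ENNReal.ofReal_le_ofReal (hpt ξ)
    _ = ENNReal.ofReal (∫ ξ, F ξ ∂(Measure.pi fun _ => P)) :=
        (ofReal_integral_eq_lintegral_ofReal hF (ae_of_all _ hF0)).symm
    _ ≤ _ := ENNReal.ofReal_le_ofReal hC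

/-- Risk bound for the estimator of the dense zone, valid for every `θ`. -/
lemma dense_risk_le {a τ M : ℝ} {P : Measure ℝ} (hP : P ∈ noiseClass a τ)
    (hi4 : Integrable (fun x : ℝ => x ^ 4) P) (h4 : ∫ x, x ^ 4 ∂P ≤ M)
    {d : ℕ} (hd : 0 < d) (θ : Fin d → ℝ) {σ : ℝ} (hσ : 0 < σ) :
    ∫⁻ y, ENNReal.ofReal ((√|∑ j, y j ^ 2 - d * σ ^ 2| - l2norm θ) ^ 2) ∂(law θ P σ) ≤
      ENNReal.ofReal ((M + 17) * σ ^ 2 * √d) := by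
  obtain ⟨hprob, h2, hmean, hvar, -⟩ := hP
  have hd1 : (1 : ℝ) ≤ d := by exact_mod_cast hd
  have hsq1 : 1 ≤ √(d : ℝ) := Real.one_le_sqrt.mpr hd1
  have hsq0 : 0 < √(d : ℝ) := by linarith
  have hsqd : √(d : ℝ) * √d = d := Real.mul_self_sqrt (by linarith)
  obtain ⟨hiA, hA⟩ := integral_sum_sub_sq_le (P := P) (f := fun i x => θ i * x)
    fun i => h2.const_mul (θ i)
  have hm4 : MemLp (fun x : ℝ => x ^ 2) 2 P :=
    (memLp_two_iff_integrable_sq (by fun_prop)).mpr (by simpa [← pow_mul] using hi4)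
  obtain ⟨hiB, hB⟩ := integral_sum_sub_sq_le (d := d) (P := P) (f := fun _ x => x ^ 2) fun i => hm4
  have hm1 : ∀ i, ∫ x, θ i * x ∂P = 0 := fun i => by rw [integral_const_mul, hmean, mul_zero]
  have hm2 : ∀ i, ∫ x, (θ i * x) ^ 2 ∂P = θ i ^ 2 := fun i => by
    simp only [mul_pow]
    rw [integral_const_mul, hvar, mul_one]
  simp only [hm1, hm2, Finset.sum_const_zero, sub_zero, ← l2norm_sq] at hiA hA
  simp only [hvar, Finset.sum_const, Finset.card_univ, Fintype.card_fin, nsmul_eq_mul, mul_one,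
    ← pow_mul] at hiB hB
  set n := l2norm θ with hn
  have hn0 : 0 ≤ n := l2norm_nonneg θ
  -- `2 |B|` is split by the arithmetic-geometric mean inequality at the scale `σ² √d`; for `θ = 0`
  -- the last term is `0`, by division by zero
  refine lintegral_law_le (f := fun y => (√|∑ j, y j ^ 2 - d * σ ^ 2| - n) ^ 2)
    (F := fun ξ => σ ^ 2 / √d * (∑ i, ξ i ^ 2 - d) ^ 2 + σ ^ 2 * √d +
      16 * σ ^ 2 / n ^ 2 * (∑ i, θ i * ξ i) ^ 2) (fun ξ => ?_) (fun ξ => by positivity)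
    (((hiB.const_mul _).add (integrable_const _)).add (hiA.const_mul _)) ?_
  · have e1 : ∑ j, (θ j + σ * ξ j) ^ 2 - d * σ ^ 2 =
        n ^ 2 + 2 * σ * ∑ i, θ i * ξ i + σ ^ 2 * (∑ i, ξ i ^ 2 - d) := by
      rw [hn, l2norm_sq, mul_sub, Finset.mul_sum, Finset.mul_sum, ← add_sub_assoc,
        ← Finset.sum_add_distrib, ← Finset.sum_add_distrib]
      congr 1
      · exact Finset.sum_congr rfl fun j _ => by ring
      · ring
    have hzero : n = 0 → 2 * σ * ∑ i, θ i * ξ i = 0 := by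
      intro h
      have h3 : ∑ i, θ i ^ 2 = 0 := by rw [← l2norm_sq, ← hn, h]; norm_num
      have h4 := (Finset.sum_eq_zero_iff_of_nonneg fun i _ => sq_nonneg (θ i)).mp h3
      have h5 : ∀ i, θ i = 0 := fun i => by simpa using h4 i (Finset.mem_univ i)
      simp [h5]
    have h3 := sq_sqrt_abs_sub_le (B := σ ^ 2 * (∑ i, ξ i ^ 2 - d)) hn0 hzero
    simp only [e1]
    refine h3.trans (add_le_add ?_ (le_of_eq (by ring)))
    set b := ∑ i, ξ i ^ 2 - (d : ℝ)
    rw [abs_mul, abs_of_nonneg (sq_nonneg σ)]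
    have h5 : 2 * |b| ≤ b ^ 2 / √d + √d := by
      rw [← sub_nonneg]
      have e2 : b ^ 2 / √d + √d - 2 * |b| = (|b| - √d) ^ 2 / √d := by
        rw [← sq_abs b]; field_simp; ring
      rw [e2]
      positivity
    calc 2 * (σ ^ 2 * |b|) = σ ^ 2 * (2 * |b|) := by ring
      _ ≤ σ ^ 2 * (b ^ 2 / √d + √d) := mul_le_mul_of_nonneg_left h5 (sq_nonneg _)
      _ = _ := by ring
  · have hiAB : Integrable (fun ξ : Fin d → ℝ => σ ^ 2 / √d * (∑ i, ξ i ^ 2 - d) ^ 2 + σ ^ 2 * √d)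
        (Measure.pi fun _ => P) := (hiB.const_mul _).add (integrable_const _)
    rw [integral_add hiAB (hiA.const_mul _), integral_add (hiB.const_mul _) (integrable_const _),
      integral_const_mul, integral_const_mul, integral_const_mul]
    simp only [integral_const, probReal_univ, smul_eq_mul, one_mul]
    have h5 : σ ^ 2 / √d * ∫ ξ : Fin d → ℝ, (∑ i, ξ i ^ 2 - d) ^ 2 ∂(Measure.pi fun _ => P) ≤
        σ ^ 2 / √d * (d * M) := by
      refine mul_le_mul_of_nonneg_left (hB.trans ?_) (by positivity)
      exact mul_le_mul_of_nonneg_left h4 (by positivity)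
    have e3 : σ ^ 2 / √d * (d * M) = σ ^ 2 * √d * M := by
      rw [div_mul_eq_mul_div, div_eq_iff hsq0.ne']
      linear_combination (-(σ ^ 2 * M)) * hsqd
    have h6 : 16 * σ ^ 2 / n ^ 2 * ∫ ξ : Fin d → ℝ, (∑ i, θ i * ξ i) ^ 2 ∂(Measure.pi fun _ => P) ≤
        16 * σ ^ 2 := by
      rcases hn0.eq_or_lt with h | h
      · rw [← h]; simp; positivity
      · refine (mul_le_mul_of_nonneg_left hA (by positivity)).trans_eq ?_
        field_simp
    have h7 : 16 * σ ^ 2 ≤ 16 * σ ^ 2 * √d := le_mul_of_one_le_right (by positivity) hsq1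
    nlinarith

/-- Risk bound for the estimator of the sparse zone, with `m ≈ d / K` blocks. -/
lemma exists_sparse_risk_le {a τ : ℝ} (ha : 0 < a) (hτ : 0 < τ) :
    ∃ (K : ℕ) (c C : ℝ), 2 ≤ K ∧ 0 < c ∧ 0 < C ∧
      ∀ (s d m : ℕ) (σ : ℝ), 1 ≤ s → 4 * s < m → m * K ≤ d → d ≤ K * (m + 1) → 0 < σ →
      ∀ B : Fin m → Finset (Fin d), IsBlockPartition B →
      ∀ v : (Fin d → ℝ) → ℝ, IsMedianOfMeans B v →
      ∀ θhat : (Fin d → ℝ) → (Fin d → ℝ), IsSlopeEstimator (weight a c d) v θhat →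
      ∀ P ∈ noiseClass a τ, ∀ θ ∈ sparse d s,
        ∫⁻ y, ENNReal.ofReal ((l2norm (θhat y) - l2norm θ) ^ 2) ∂(law θ P σ) ≤
          ENNReal.ofReal (C * σ ^ 2 * (s * Real.log (Real.exp 1 * d / s) ^ (2 / a))) := by
  obtain ⟨M, hM, hmom⟩ := exists_moment_bounds ha hτ
  obtain ⟨c, C₁, hc, hC₁, hexc⟩ := exists_excess_le ha hτ hM
  obtain ⟨C₂, hC₂, hwt⟩ := exists_sum_weight_sq_le ha (8 * c)
  -- blocks of at least `48 M` coordinates, as the union bound over blocks requires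
  set K : ℕ := ⌈48 * M⌉₊ with hK
  have hK48 : 48 * M ≤ K := Nat.le_ceil _
  have hK2 : (2 : ℝ) ≤ K := by linarith
  have hK0 : (0 : ℝ) < K := by linarith
  refine ⟨K, 8 * c, 8 * (C₁ * M + M + (K : ℝ) ^ 2) + 32 * C₂, by exact_mod_cast hK2,
    by positivity, by positivity, ?_⟩
  intro s d m σ hs hsm' hmd' hdm' hσ B hB v hv θhat hθhat P hP θ hθ
  have hm0 : (0 : ℝ) < m := by exact_mod_cast (by omega : 0 < m)
  have hmd : (m : ℝ) * K ≤ d := by exact_mod_cast hmd'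
  have hdm : (d : ℝ) ≤ K * (m + 1) := by exact_mod_cast hdm'
  have hmpos : 0 < m := by omega
  have hcard : ∀ i, 48 * M ≤ ((B i).card : ℝ) := fun i => by
    have h1 : K ≤ d / m := (Nat.le_div_iff_mul_le hmpos).mpr (by rwa [mul_comm])
    have h2 : K ≤ (B i).card := h1.trans (hB.2.2 i)
    exact hK48.trans (by exact_mod_cast h2)
  have hd1 : (1 : ℝ) ≤ m := by exact_mod_cast hmpos
  have hd0 : (0 : ℝ) < d := by nlinarith
  have hd : 0 < d := by exact_mod_cast hd0
  have hsd : s ≤ d := by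
    have : m * 1 ≤ m * K := Nat.mul_le_mul_left m (by exact_mod_cast (by linarith : (1 : ℝ) ≤ K))
    omega
  obtain ⟨hg, hgM, hi4, h4⟩ := hmom P hP
  obtain ⟨hprob, h2, -, hvar, -⟩ := hP
  set e := ∫ x, expMoment a τ x ∂P with he
  have hgi : Integrable (expMoment a τ) P := hg.integrable one_le_two
  have he1 : 1 ≤ e := by
    have := integral_mono (integrable_const (1 : ℝ)) hgi fun x => one_le_expMoment hτ x
    simpa using this
  have heM : e ≤ M := by
    refine (integral_mono hgi hg.integrable_sq fun x => ?_).trans hgM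
    have := one_le_expMoment (a := a) hτ x
    nlinarith
  obtain ⟨hiE, hE⟩ := integral_sum_sub_sq_le (d := d) (P := P) (f := fun _ => expMoment a τ)
    fun _ => hg
  simp only [Finset.sum_const, Finset.card_univ, Fintype.card_fin, nsmul_eq_mul, ← he] at hiE hE
  obtain ⟨hiS, hS⟩ := integral_smallBlocksBound_le hB hM h2 hvar hi4 h4 hcard
  obtain ⟨hiV, hV⟩ := integral_sum_blockMean (B := B) h2 hvar
  have hi4' : ∀ i : Fin d, Integrable (fun ξ : Fin d → ℝ => ξ i ^ 4) (Measure.pi fun _ => P) :=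
    fun i => integrable_comp_eval (μ := fun _ => P) (f := fun x : ℝ => x ^ 4) hi4
  have hi4s : Integrable (fun ξ : Fin d → ℝ => ∑ i, ξ i ^ 4) (Measure.pi fun _ => P) :=
    integrable_finsetSum _ fun i _ => hi4' i
  have h4s : ∫ ξ : Fin d → ℝ, ∑ i, ξ i ^ 4 ∂(Measure.pi fun _ => P) ≤ d * M := by
    rw [integral_finsetSum _ fun i _ => hi4' i]
    refine (Finset.sum_le_card_nsmul _ _ M fun i _ => ?_).trans_eq (by simp)
    rw [integral_comp_eval (μ := fun _ : Fin d => P) (f := fun x : ℝ => x ^ 4) hi4.1]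
    exact h4
  set D := ∑ j : Fin d, (if (j : ℕ) < s then weight a (8 * c) d j else 0) ^ 2 with hD
  have hD0 : 0 ≤ D := Finset.sum_nonneg fun j _ => sq_nonneg _
  have hDle := hwt s d hs hsd
  set ρ := (s : ℝ) * Real.log (Real.exp 1 * d / s) ^ (2 / a) with hρ
  have hs1 : (1 : ℝ) ≤ s := by exact_mod_cast hs
  have hρ1 : 1 ≤ ρ := by
    have hL := one_le_log_exp_mul_div (by linarith) (by exact_mod_cast hsd : (s : ℝ) ≤ d)
    exact one_le_mul_of_one_le_of_one_le hs1 (Real.one_le_rpow hL (by positivity))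
  refine lintegral_law_le (f := fun y => (l2norm (θhat y) - l2norm θ) ^ 2) (F := fun ξ =>
    8 * σ ^ 2 * C₁ / d * (∑ i, expMoment a τ (ξ i) - d * e) ^ 2 + 8 * σ ^ 2 / d * ∑ i, ξ i ^ 4 +
      8 * σ ^ 2 * d ^ 2 * smallBlocksBound B M ξ +
      32 * σ ^ 2 * D / m * ∑ i, blockMean B ξ i) (fun ξ => ?_) (fun ξ => ?_)
    ((((hiE.const_mul _).add (hi4s.const_mul _)).add (hiS.const_mul _)).add (hiV.const_mul _)) ?_
  · have hlam := weight_antitone (c := 8 * c) ha (by positivity) d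
    have hx := hv.2 (fun j => θ j + σ * ξ j)
    have hmin := hθhat.2 (fun j => θ j + σ * ξ j) (Set.mem_univ θ)
    have h1 := slope_sq_error_le hB hlam (weight_nonneg (by positivity)) hθ hsm' hσ hx hmin
    refine h1.trans ?_
    have h3 := hexc d ξ e he1 heM
    have h5 : ∀ j : Fin d, weight a (8 * c) d j / 8 = weight a c d j := fun j => by
      unfold weight; ring
    simp only [h5]
    have h6 := indicator_smallBlocks_le hd hB (by linarith : 0 < M) ξ
    have h7 := median_le hB hθ hsm' hx
    have h8 : v (fun j => θ j + σ * ξ j) * D ≤ 4 * σ ^ 2 * (∑ i, blockMean B ξ i) / m * D := by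
      refine mul_le_mul_of_nonneg_right ?_ hD0
      rw [le_div_iff₀ hm0]; linarith
    have h9 := mul_le_mul_of_nonneg_left (add_le_add h3 h6) (by positivity : 0 ≤ 8 * σ ^ 2)
    rw [← hD]
    calc _ ≤ 8 * σ ^ 2 * (C₁ * ((∑ i, expMoment a τ (ξ i) - d * e) ^ 2 / d) +
          ((∑ i, ξ i ^ 4) / d + (d : ℝ) ^ 2 * smallBlocksBound B M ξ)) +
          8 * (4 * σ ^ 2 * (∑ i, blockMean B ξ i) / m * D) := by linarith
      _ = _ := by ring
  · have h1 := smallBlocksBound_nonneg B M ξ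
    have h3 : 0 ≤ ∑ i, blockMean B ξ i := Finset.sum_nonneg fun i _ => blockMean_nonneg B ξ i
    positivity
  · have hi12 := (hiE.const_mul (8 * σ ^ 2 * C₁ / d)).add (hi4s.const_mul (8 * σ ^ 2 / d))
    have hi123 := hi12.add (hiS.const_mul (8 * σ ^ 2 * d ^ 2))
    have e1 := integral_add hi123 (hiV.const_mul (32 * σ ^ 2 * D / m))
    have e2 := integral_add hi12 (hiS.const_mul (8 * σ ^ 2 * d ^ 2))
    have e3 := integral_add (hiE.const_mul (8 * σ ^ 2 * C₁ / d)) (hi4s.const_mul (8 * σ ^ 2 / d))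
    simp only [Pi.add_apply, integral_const_mul] at e1 e2 e3
    rw [e1, e2, e3]
    have b1 : 8 * σ ^ 2 * C₁ / d * ∫ ξ : Fin d → ℝ, (∑ i, expMoment a τ (ξ i) - d * e) ^ 2
        ∂(Measure.pi fun _ => P) ≤ 8 * σ ^ 2 * (C₁ * M) := by
      refine (mul_le_mul_of_nonneg_left
        (hE.trans (mul_le_mul_of_nonneg_left hgM hd0.le)) (by positivity)).trans_eq ?_
      field_simp
    have b2 : 8 * σ ^ 2 / d * ∫ ξ : Fin d → ℝ, ∑ i, ξ i ^ 4 ∂(Measure.pi fun _ => P) ≤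
        8 * σ ^ 2 * M := by
      refine (mul_le_mul_of_nonneg_left h4s (by positivity)).trans_eq ?_
      field_simp
    have b3 : 8 * σ ^ 2 * d ^ 2 * ∫ ξ, smallBlocksBound B M ξ ∂(Measure.pi fun _ => P) ≤
        8 * σ ^ 2 * (K : ℝ) ^ 2 := by
      rw [mul_assoc (8 * σ ^ 2)]
      refine mul_le_mul_of_nonneg_left ?_ (by positivity)
      have h5 : (d : ℝ) ^ 2 ≤ (K * (m + 1)) ^ 2 := pow_le_pow_left₀ hd0.le hdm 2
      have h6 : ((m : ℝ) + 1) ≤ 2 ^ m := by exact_mod_cast Nat.lt_two_pow_self (n := m)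
      calc (d : ℝ) ^ 2 * ∫ ξ, smallBlocksBound B M ξ ∂(Measure.pi fun _ => P)
          ≤ (K * 2 ^ m) ^ 2 * (1 / 4) ^ m :=
            mul_le_mul (h5.trans (pow_le_pow_left₀ (by positivity)
              (mul_le_mul_of_nonneg_left h6 hK0.le) 2)) hS
              (integral_nonneg fun ξ => smallBlocksBound_nonneg B M ξ) (by positivity)
        _ = (K : ℝ) ^ 2 := by
            rw [mul_pow, ← pow_mul, mul_comm m 2, pow_mul, mul_assoc, ← mul_pow]; norm_num
    have b4 : 32 * σ ^ 2 * D / m * ∫ ξ, ∑ i, blockMean B ξ i ∂(Measure.pi fun _ => P) ≤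
        32 * σ ^ 2 * (C₂ * ρ) := by
      refine (mul_le_mul_of_nonneg_left hV (by positivity)).trans ?_
      rw [div_mul_cancel₀ _ hm0.ne']
      exact mul_le_mul_of_nonneg_left hDle (by positivity)
    have b5 : 8 * σ ^ 2 * (C₁ * M + M + (K : ℝ) ^ 2) ≤
        8 * σ ^ 2 * (C₁ * M + M + (K : ℝ) ^ 2) * ρ := le_mul_of_one_le_right (by positivity) hρ1
    linarith

/-- The upper bound: each of the two zones is handled by its own estimator. -/
lemma exists_risk_le {a τ : ℝ} (ha : 0 < a) (hτ : 0 < τ) :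
    ∃ γ c C : ℝ, 0 < γ ∧ γ ≤ 1 / 2 ∧ 0 < c ∧ 0 < C ∧
      ∀ (s d : ℕ) (σ : ℝ), 1 ≤ s → (s : ℝ) < (⌊γ * (d : ℝ)⌋₊ : ℝ) / 4 → 0 < σ →
      ∀ B : Fin ⌊γ * (d : ℝ)⌋₊ → Finset (Fin d), IsBlockPartition B →
      ∀ v : (Fin d → ℝ) → ℝ, IsMedianOfMeans B v →
      ∀ θhat : (Fin d → ℝ) → (Fin d → ℝ), IsSlopeEstimator (weight a c d) v θhat →
        (⨆ P ∈ noiseClass a τ, ⨆ θ ∈ sparse d s,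
          ∫⁻ y, ENNReal.ofReal ((normEstimator a σ s θhat y - l2norm θ) ^ 2) ∂(law θ P σ))
          ≤ ENNReal.ofReal (C * σ ^ 2 * rate a s d ^ 2) := by
  obtain ⟨M, hM, hmom⟩ := exists_moment_bounds ha hτ
  obtain ⟨K, c, C, hK2, hc, hC, h⟩ := exists_sparse_risk_le ha hτ
  have hK2' : (2 : ℝ) ≤ K := by exact_mod_cast hK2
  have hK0 : (0 : ℝ) < K := by linarith
  refine ⟨1 / K, c, max C ((M + 17) * 2 ^ (2 / a)), by positivity,
    one_div_le_one_div_of_le (by norm_num) hK2', hc, lt_max_of_lt_left hC, ?_⟩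
  intro s d σ hs hsm hσ
  have hfloor : ⌊1 / (K : ℝ) * (d : ℝ)⌋₊ = d / K := by
    rw [one_div_mul_eq_div, Nat.floor_div_natCast, Nat.floor_natCast]
  rw [hfloor] at hsm ⊢
  intro B hB v hv θhat hθhat
  refine iSup₂_le fun P hP => iSup₂_le fun θ hθ => ?_
  have hsm' : 4 * s < d / K := by
    rw [lt_div_iff₀ (by norm_num)] at hsm
    rw [mul_comm]
    exact_mod_cast hsm
  have hsd : s ≤ d := by
    have := Nat.div_le_self d K
    omega
  have hd : 0 < d := by omega
  unfold normEstimator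
  split_ifs with hz
  · refine (h s d (d / K) σ hs hsm' (Nat.div_mul_le_self d K)
      (Nat.lt_mul_div_succ d (by omega)).le hσ B hB v hv θhat hθhat P hP θ hθ).trans
      (ENNReal.ofReal_le_ofReal ?_)
    rw [← rate_sq_of_sparse_zone ha hs hsd hz]
    gcongr
    exact le_max_left _ _
  · obtain ⟨-, -, hi4, h4⟩ := hmom P hP
    refine (dense_risk_le hP hi4 h4 hd θ hσ).trans (ENNReal.ofReal_le_ofReal ?_)
    calc (M + 17) * σ ^ 2 * √d ≤ (M + 17) * σ ^ 2 * (2 ^ (2 / a) * rate a s d ^ 2) := by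
          gcongr
          exact sqrt_le_rate_sq_of_dense_zone ha hs hsd hz
      _ = (M + 17) * 2 ^ (2 / a) * σ ^ 2 * rate a s d ^ 2 := by ring
      _ ≤ _ := by
          gcongr
          exact le_max_right _ _

/-! ### Product laws with finitely many atoms -/

/-- The measure on a finite type with point masses `w`. -/
noncomputable def atomic {ι : Type*} [Fintype ι] [MeasurableSpace ι] (w : ι → ℝ) : Measure ι :=
  ∑ x, ENNReal.ofReal (w x) • Measure.dirac x

lemma isProbabilityMeasure_atomic {ι : Type*} [Fintype ι] [MeasurableSpace ι]
    {w : ι → ℝ} (h0 : ∀ x, 0 ≤ w x) (h1 : ∑ x, w x = 1) :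
    IsProbabilityMeasure (atomic w) := by
  constructor
  simp [atomic, Measure.finsetSum_apply, ← ENNReal.ofReal_sum_of_nonneg fun x _ => h0 x, h1]

lemma sum_prod_eq_one {ι : Type*} [Fintype ι] {w : ι → ℝ} (h1 : ∑ x, w x = 1) (d : ℕ) :
    ∑ ω : Fin d → ι, ∏ i, w (ω i) = 1 := by
  rw [← Fintype.sum_pow, h1, one_pow]

/-- Tensorization of the `χ²` divergence: on any event, the product weights of `w` exceed
those of its perturbation `w (1 + ε h)` by at most `√(exp (d ε²) - 1)`. -/
lemma sum_prod_sub_le {ι : Type*} [Fintype ι] {w h : ι → ℝ} (h0 : ∀ x, 0 ≤ w x) (h1 : ∑ x, w x = 1)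
    (hh : ∑ x, w x * h x = 0) (hh2 : ∑ x, w x * h x ^ 2 ≤ 1) {ε : ℝ} {d : ℕ}
    (A : Finset (Fin d → ι)) :
    ∑ ω ∈ A, ∏ i, w (ω i) - ∑ ω ∈ A, ∏ i, (w (ω i) * (1 + ε * h (ω i))) ≤
      √(Real.exp (d * ε ^ 2) - 1) := by
  set p : (Fin d → ι) → ℝ := fun ω => ∏ i, w (ω i) with hp
  set R : (Fin d → ι) → ℝ := fun ω => ∏ i, (1 + ε * h (ω i)) with hR
  have hp0 : ∀ ω, 0 ≤ p ω := fun ω => Finset.prod_nonneg fun i _ => h0 _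
  have hp1 : ∑ ω, p ω = 1 := sum_prod_eq_one h1 d
  have hpR : ∑ ω, p ω * R ω = 1 := by
    simp only [hp, hR, ← Finset.prod_mul_distrib]
    rw [← Fintype.sum_pow fun x => w x * (1 + ε * h x)]
    have : ∑ x, w x * (1 + ε * h x) = 1 := by
      simp only [mul_add, mul_one, Finset.sum_add_distrib, h1, mul_left_comm _ ε,
        ← Finset.mul_sum, hh, mul_zero, add_zero]
    rw [this, one_pow]
  have hpR2 : ∑ ω, p ω * R ω ^ 2 ≤ Real.exp (d * ε ^ 2) := by
    simp only [hp, hR, ← Finset.prod_pow, ← Finset.prod_mul_distrib]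
    rw [← Fintype.sum_pow fun x => w x * (1 + ε * h x) ^ 2, Real.exp_nat_mul]
    refine pow_le_pow_left₀ (Finset.sum_nonneg fun x _ => mul_nonneg (h0 x) (sq_nonneg _)) ?_ d
    have e1 : ∑ x, w x * (1 + ε * h x) ^ 2 =
        ∑ x, w x + 2 * ε * ∑ x, w x * h x + ε ^ 2 * ∑ x, w x * h x ^ 2 := by
      rw [Finset.mul_sum, Finset.mul_sum, ← Finset.sum_add_distrib, ← Finset.sum_add_distrib]
      exact Finset.sum_congr rfl fun x _ => by ring
    rw [e1, h1, hh, mul_zero, add_zero]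
    have := mul_le_mul_of_nonneg_left hh2 (sq_nonneg ε)
    have := Real.add_one_le_exp (ε ^ 2)
    linarith
  have hvar : ∑ ω, p ω * (1 - R ω) ^ 2 ≤ Real.exp (d * ε ^ 2) - 1 := by
    have e1 : ∑ ω, p ω * (1 - R ω) ^ 2 = ∑ ω, p ω - 2 * ∑ ω, p ω * R ω + ∑ ω, p ω * R ω ^ 2 := by
      rw [Finset.mul_sum, ← Finset.sum_sub_distrib, ← Finset.sum_add_distrib]
      exact Finset.sum_congr rfl fun x _ => by ring
    rw [e1, hp1, hpR]
    linarith
  have hcs : ∑ ω, √(p ω) * (√(p ω) * |1 - R ω|) ≤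
      √(∑ ω, √(p ω) ^ 2) * √(∑ ω, (√(p ω) * |1 - R ω|) ^ 2) := Real.sum_mul_le_sqrt_mul_sqrt _ _ _
  simp only [mul_pow, Real.sq_sqrt (hp0 _), sq_abs, hp1, Real.sqrt_one, one_mul] at hcs
  calc ∑ ω ∈ A, ∏ i, w (ω i) - ∑ ω ∈ A, ∏ i, (w (ω i) * (1 + ε * h (ω i)))
      = ∑ ω ∈ A, p ω * (1 - R ω) := by
        rw [← Finset.sum_sub_distrib]
        exact Finset.sum_congr rfl fun ω _ => by
          rw [Finset.prod_mul_distrib]; simp only [hp, hR]; ring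
    _ ≤ ∑ ω ∈ A, p ω * |1 - R ω| :=
        Finset.sum_le_sum fun ω _ => mul_le_mul_of_nonneg_left (le_abs_self _) (hp0 ω)
    _ ≤ ∑ ω, p ω * |1 - R ω| := Finset.sum_le_sum_of_subset_of_nonneg (Finset.subset_univ A)
        fun ω _ _ => mul_nonneg (hp0 ω) (abs_nonneg _)
    _ = ∑ ω, √(p ω) * (√(p ω) * |1 - R ω|) :=
        Finset.sum_congr rfl fun ω _ => by rw [← mul_assoc, Real.mul_self_sqrt (hp0 ω)]
    _ ≤ √(∑ ω, p ω * (1 - R ω) ^ 2) := hcs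
    _ ≤ _ := Real.sqrt_le_sqrt hvar

section FiniteModel

variable {ι : Type*} [Fintype ι] [MeasurableSpace ι] [MeasurableSingletonClass ι]

lemma atomic_singleton (w : ι → ℝ) (x : ι) : atomic w {x} = ENNReal.ofReal (w x) := by
  classical
  simp only [atomic, Measure.finsetSum_apply, Measure.smul_apply, smul_eq_mul,
    Measure.dirac_apply' _ (measurableSet_singleton x), Set.indicator_apply,
    Set.mem_singleton_iff, Pi.one_apply, mul_ite, mul_one, mul_zero]
  simp

lemma integral_atomic {w : ι → ℝ} (h0 : ∀ x, 0 ≤ w x) (h1 : ∑ x, w x = 1) (f : ι → ℝ) :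
    ∫ x, f x ∂(atomic w) = ∑ x, w x * f x := by
  have := isProbabilityMeasure_atomic h0 h1
  rw [integral_fintype .of_finite]
  refine Finset.sum_congr rfl fun x _ => ?_
  rw [measureReal_def, atomic_singleton, ENNReal.toReal_ofReal (h0 x), smul_eq_mul]

lemma pi_atomic_singleton {w : ι → ℝ} (h0 : ∀ x, 0 ≤ w x) (h1 : ∑ x, w x = 1) {d : ℕ}
    (ω : Fin d → ι) :
    (Measure.pi fun _ : Fin d => atomic w) {ω} = ENNReal.ofReal (∏ i, w (ω i)) := by
  have := isProbabilityMeasure_atomic h0 h1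
  rw [Measure.pi_singleton, ENNReal.ofReal_prod_of_nonneg fun i _ => h0 _]
  exact Finset.prod_congr rfl fun i _ => atomic_singleton _ _

lemma integral_pi_atomic {w : ι → ℝ} (h0 : ∀ x, 0 ≤ w x) (h1 : ∑ x, w x = 1) {d : ℕ}
    (f : (Fin d → ι) → ℝ) :
    ∫ ω, f ω ∂(Measure.pi fun _ : Fin d => atomic w) = ∑ ω, (∏ i, w (ω i)) * f ω := by
  have := isProbabilityMeasure_atomic h0 h1
  rw [integral_fintype .of_finite]
  refine Finset.sum_congr rfl fun ω _ => ?_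
  rw [measureReal_def, pi_atomic_singleton h0 h1,
    ENNReal.toReal_ofReal (Finset.prod_nonneg fun i _ => h0 _), smul_eq_mul]

/-- Lower bound for the risk under a noise law with finitely many atoms. -/
lemma le_risk_atomic {w : ι → ℝ} (h0 : ∀ x, 0 ≤ w x) (h1 : ∑ x, w x = 1) (F : ι → ℝ) {d : ℕ}
    (θ : Fin d → ℝ) {σ : ℝ} (hσ : 0 < σ) {ℓ : ℝ≥0 → ℝ≥0} (hℓ : Monotone ℓ) {t₀ : ℝ≥0} {b Δ : ℝ}
    (hb : 0 ≤ b) (hbΔ : (t₀ : ℝ) ≤ b * Δ) {T : (Fin d → ℝ) → ℝ} (hT : Measurable T) (n : ℝ)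
    (A : Finset (Fin d → ι)) (hA : ∀ ω ∈ A, σ * Δ ≤ |T (fun i => θ i + σ * F (ω i)) - n|) :
    ENNReal.ofReal (ℓ t₀ * ∑ ω ∈ A, ∏ i, w (ω i)) ≤
      ∫⁻ y, (ℓ (Real.toNNReal (b * |(T y - n) / σ|)) : ℝ≥0∞)
        ∂(law θ ((atomic w).map F) σ) := by
  have := isProbabilityMeasure_atomic h0 h1
  have hF : Measurable F := measurable_of_finite F
  have hprob : IsProbabilityMeasure ((atomic w).map F) :=
    Measure.isProbabilityMeasure_map hF.aemeasurable
  have hmeas : Measurable fun y => (ℓ (Real.toNNReal (b * |(T y - n) / σ|)) : ℝ≥0∞) := by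
    have := hℓ.measurable
    have h2 : Measurable fun y => Real.toNNReal (b * |(T y - n) / σ|) := by fun_prop
    exact (this.comp h2).coe_nnreal_ennreal
  have hF' : Measurable fun (ω : Fin d → ι) i => F (ω i) := by fun_prop
  have hlaw : law θ ((atomic w).map F) σ =
      (Measure.pi fun _ : Fin d => atomic w).map (fun ω i => θ i + σ * F (ω i)) := by
    unfold law
    rw [← Measure.pi_map_pi (fun _ => hF.aemeasurable), Measure.map_map (by fun_prop) hF']
    rfl
  have hF'' : Measurable fun (ω : Fin d → ι) i => θ i + σ * F (ω i) := by fun_prop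
  rw [hlaw, lintegral_map hmeas hF'', lintegral_fintype]
  have hsum : ENNReal.ofReal (ℓ t₀ * ∑ ω ∈ A, ∏ i, w (ω i)) =
      ∑ ω ∈ A, ENNReal.ofReal (ℓ t₀ * ∏ i, w (ω i)) := by
    rw [Finset.mul_sum]
    exact ENNReal.ofReal_sum_of_nonneg fun ω _ =>
      mul_nonneg (NNReal.coe_nonneg (ℓ t₀)) (Finset.prod_nonneg fun i _ => h0 _)
  rw [hsum]
  refine le_trans (Finset.sum_le_sum fun ω hω => ?_)
    (Finset.sum_le_sum_of_subset (Finset.subset_univ A))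
  rw [pi_atomic_singleton h0 h1, ENNReal.ofReal_mul (NNReal.coe_nonneg (ℓ t₀)),
    ENNReal.ofReal_coe_nnreal]
  refine mul_le_mul_left ?_ _
  rw [ENNReal.coe_le_coe]
  refine hℓ (NNReal.le_toNNReal_of_coe_le (hbΔ.trans (mul_le_mul_of_nonneg_left ?_ hb)))
  rw [abs_div, abs_of_pos hσ, le_div_iff₀ hσ, mul_comm]
  exact hA ω hω

/-- With success probability `s / (4 d)`, the number of successes among `d` trials lies between
`s / 16` and `s` with probability at least `1 / 16`: the indicator of this event dominates a
concave quadratic polynomial in the number of successes. -/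
lemma le_sum_prod_count {w : ι → ℝ} (h0 : ∀ x, 0 ≤ w x) (h1 : ∑ x, w x = 1) (S : ι → Prop)
    [DecidablePred S] {s d : ℕ} (hs : 1 ≤ s) (hd : 0 < d)
    (hp : ∑ x, w x * (if S x then 1 else 0) = s / (4 * d)) :
    1 / 16 ≤ ∑ ω ∈ (Finset.univ : Finset (Fin d → ι)).filter (fun ω =>
      (Finset.univ.filter fun i => S (ω i)).card ≤ s ∧
        s ≤ 16 * (Finset.univ.filter fun i => S (ω i)).card), ∏ i, w (ω i) := by
  have hprob := isProbabilityMeasure_atomic h0 h1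
  have hs0 : (1 : ℝ) ≤ s := by exact_mod_cast hs
  have hd0 : (0 : ℝ) < d := by exact_mod_cast hd
  set g : ι → ℝ := fun x => if S x then 1 else 0 with hg
  set N : (Fin d → ι) → ℕ := fun ω => (Finset.univ.filter fun i => S (ω i)).card with hN
  have hNg : ∀ ω, ∑ i, g (ω i) = N ω := fun ω => by simp [hg, hN]
  have hmean : ∑ ω : Fin d → ι, (∏ i, w (ω i)) * (N ω : ℝ) = s / 4 := by
    rw [← integral_pi_atomic h0 h1]
    simp only [← hNg]
    rw [integral_finsetSum _ fun i _ => Integrable.of_finite]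
    rw [Finset.sum_congr rfl fun i _ => (integral_comp_eval (μ := fun _ : Fin d => atomic w)
      (i := i) (f := g) (measurable_of_finite g).aestronglyMeasurable).trans
        ((integral_atomic h0 h1 g).trans hp)]
    simp only [Finset.sum_const, Finset.card_univ, Fintype.card_fin, nsmul_eq_mul]
    field_simp
  have hvar : ∑ ω : Fin d → ι, (∏ i, w (ω i)) * ((N ω : ℝ) - (s : ℝ) / 4) ^ 2 ≤ (s : ℝ) / 4 := by
    rw [← integral_pi_atomic h0 h1]
    have h2 := (integral_sum_sub_sq_le (d := d) (P := atomic w) (f := fun _ => g)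
      fun _ => MemLp.of_discrete).2
    have hg2 : ∀ x, g x ^ 2 = g x := fun x => by simp only [hg]; split_ifs <;> norm_num
    simp only [hg2, integral_atomic h0 h1] at h2
    simp only [hg, hp, Finset.sum_const, Finset.card_univ, Fintype.card_fin, nsmul_eq_mul] at h2
    have e1 : (d : ℝ) * (s / (4 * d)) = s / 4 := by field_simp
    simp only [e1] at h2
    simpa only [← hNg] using h2
  have hone := sum_prod_eq_one h1 d
  rw [Finset.sum_filter]
  have hpt : ∀ ω : Fin d → ι, (∏ i, w (ω i)) *
      (((N ω : ℝ) / s - 1 / 16) * (1 + 1 / s - (N ω : ℝ) / s)) ≤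
      if N ω ≤ s ∧ s ≤ 16 * N ω then ∏ i, w (ω i) else 0 := by
    intro ω
    have hp0 : 0 ≤ ∏ i, w (ω i) := Finset.prod_nonneg fun i _ => h0 _
    have hs1 : 1 / (s : ℝ) ≤ 1 := by rw [div_le_one (by linarith)]; exact hs0
    have hs2 : 0 < 1 / (s : ℝ) := by positivity
    split_ifs with hc
    · refine mul_le_of_le_one_right hp0 ?_
      have h3 : (N ω : ℝ) / s ≤ 1 := by
        rw [div_le_one (by linarith)]; exact_mod_cast hc.1
      have h4 : 1 / 16 ≤ (N ω : ℝ) / s := by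
        rw [div_le_div_iff₀ (by norm_num) (by linarith)]
        have : (s : ℝ) ≤ 16 * N ω := by exact_mod_cast hc.2
        linarith
      nlinarith
    · refine mul_nonpos_of_nonneg_of_nonpos hp0 ?_
      rw [not_and_or, not_le, not_le] at hc
      rcases hc with hc | hc
      · have h3 : 1 + 1 / (s : ℝ) ≤ (N ω : ℝ) / s := by
          rw [← sub_nonneg]
          have e2 : (N ω : ℝ) / s - (1 + 1 / s) = (N ω - (s + 1)) / s := by field_simp
          rw [e2]
          have : (s : ℝ) + 1 ≤ N ω := by exact_mod_cast hc
          exact div_nonneg (by linarith) (by linarith)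
        exact mul_nonpos_of_nonneg_of_nonpos (by linarith) (by linarith)
      · have h4 : (N ω : ℝ) / s ≤ 1 / 16 := by
          rw [div_le_div_iff₀ (by linarith) (by norm_num)]
          have : 16 * (N ω : ℝ) < s := by exact_mod_cast hc
          linarith
        exact mul_nonpos_of_nonpos_of_nonneg (by linarith) (by linarith)
  refine le_trans ?_ (Finset.sum_le_sum fun ω _ => hpt ω)
  -- expand the quadratic polynomial around the mean `s / 4`
  have e3 : ∀ ω : Fin d → ι, (∏ i, w (ω i)) *
      (((N ω : ℝ) / s - 1 / 16) * (1 + 1 / s - (N ω : ℝ) / s)) =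
      -(1 / (s : ℝ) ^ 2) * ((∏ i, w (ω i)) * ((N ω : ℝ) - s / 4) ^ 2) +
      (1 / s * (9 / 16 + 1 / s)) * ((∏ i, w (ω i)) * (N ω : ℝ)) +
      (- 1 / (16 * s)) * ∏ i, w (ω i) := by
    intro ω
    field_simp
    ring
  rw [Finset.sum_congr rfl fun ω _ => e3 ω, Finset.sum_add_distrib, Finset.sum_add_distrib,
    ← Finset.mul_sum, ← Finset.mul_sum, ← Finset.mul_sum, hmean, hone]
  have h5 := mul_le_mul_of_nonneg_left hvar (by positivity : 0 ≤ 1 / (s : ℝ) ^ 2)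
  have e4 : 1 / (s : ℝ) ^ 2 * (s / 4) = 1 / s * (1 / 4) := by field_simp
  have e5 : 1 / (s : ℝ) * (9 / 16 + 1 / s) * (s / 4) = 9 / 64 + 1 / s * (1 / 4) := by
    field_simp
    ring
  have e6 : - 1 / (16 * (s : ℝ)) * 1 = - (1 / s * (1 / 16)) := by field_simp
  have hs1 : 1 / (s : ℝ) ≤ 1 := by rw [div_le_one (by linarith)]; exact hs0
  linarith

end FiniteModel

/-! ### The lower bound -/

lemma map_atomic_mem_noiseClass {ι : Type*} [Fintype ι] [MeasurableSpace ι]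
    [MeasurableSingletonClass ι] {w F : ι → ℝ} (h0 : ∀ x, 0 ≤ w x) (h1 : ∑ x, w x = 1)
    (hmean : ∑ x, w x * F x = 0) (hvar : ∑ x, w x * F x ^ 2 = 1) {a τ : ℝ}
    (htail : ∀ t : ℝ, 2 ≤ t →
      ∑ x, w x * (if t < |F x| then 1 else 0) ≤ 2 * Real.exp (-(t / τ) ^ a)) :
    (atomic w).map F ∈ noiseClass a τ := by
  have := isProbabilityMeasure_atomic h0 h1
  have hF : Measurable F := measurable_of_finite F
  refine ⟨Measure.isProbabilityMeasure_map hF.aemeasurable, ?_, ?_, ?_, fun t ht => ?_⟩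
  · rw [memLp_map_measure_iff (by fun_prop) hF.aemeasurable]
    exact MemLp.of_discrete
  · rw [integral_map hF.aemeasurable (by fun_prop), integral_atomic h0 h1, hmean]
  · rw [integral_map hF.aemeasurable (by fun_prop), integral_atomic h0 h1, hvar]
  · refine le_trans (le_of_eq ?_) (htail t ht)
    have hm : MeasurableSet {x : ℝ | t < |x|} := measurableSet_lt measurable_const (by fun_prop)
    rw [map_measureReal_apply hF hm, ← integral_indicator_one (hF hm), integral_atomic h0 h1]
    refine Finset.sum_congr rfl fun x _ => ?_
    simp [Set.indicator_apply]

/-- The weights of the symmetric law on three points with mass `q` at both nonzero points. -/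
noncomputable def triWeight (q : ℝ) : Fin 3 → ℝ := ![1 - 2 * q, q, q]

/-- The three points `0, 1, -1`. -/
noncomputable def triPoint : Fin 3 → ℝ := ![0, 1, -1]

lemma triWeight_nonneg {q : ℝ} (h0 : 0 ≤ q) (h1 : q ≤ 1 / 2) (x : Fin 3) : 0 ≤ triWeight q x := by
  fin_cases x <;> simp [triWeight] <;> linarith

lemma abs_mul_triPoint_le {b : ℝ} (hb : 0 ≤ b) (x : Fin 3) : |b * triPoint x| ≤ b := by
  fin_cases x <;> simp [triPoint, hb, abs_of_nonneg]

lemma sum_triWeight (q : ℝ) : ∑ x, triWeight q x = 1 := by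
  simp [triWeight, Fin.sum_univ_three]; ring

/-- The weights of the pair (signal coordinate, noise coordinate) under the sparse prior: the
signal is nonzero with probability `p`, the noise is nonzero with probability `1 / 2`. -/
noncomputable def priorWeight (p : ℝ) (x : Fin 3 × Fin 3) : ℝ :=
  triWeight (p / 2) x.1 * triWeight (1 / 4) x.2

/-- The observed value of a coordinate, in units of `σ`. -/
noncomputable def observed (lam : ℝ) (x : Fin 3 × Fin 3) : ℝ :=
  lam * triPoint x.1 + √2 * triPoint x.2

/-- The direction in which the bulk of the law of `observed` is deformed in order to reduce its
second moment to `1`. -/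
noncomputable def bulkTilt (x : Fin 3 × Fin 3) : ℝ := if x.1 = 0 then ![1, -1, -1] x.2 else 0

lemma priorWeight_nonneg {p : ℝ} (h0 : 0 ≤ p) (h1 : p ≤ 1) (x : Fin 3 × Fin 3) :
    0 ≤ priorWeight p x :=
  mul_nonneg (triWeight_nonneg (by linarith) (by linarith) _)
    (triWeight_nonneg (by norm_num) (by norm_num) _)

lemma sum_priorWeight (p : ℝ) : ∑ x, priorWeight p x = 1 := by
  simp only [priorWeight, Fintype.sum_prod_type, ← Finset.mul_sum, sum_triWeight, mul_one]

lemma sum_priorWeight_bulkTilt (p : ℝ) : ∑ x, priorWeight p x * bulkTilt x = 0 := by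
  simp [priorWeight, bulkTilt, triWeight, Fintype.sum_prod_type, Fin.sum_univ_three]
  ring

lemma sum_priorWeight_bulkTilt_sq {p : ℝ} (h0 : 0 ≤ p) :
    ∑ x, priorWeight p x * bulkTilt x ^ 2 ≤ 1 := by
  simp [priorWeight, bulkTilt, triWeight, Fintype.sum_prod_type, Fin.sum_univ_three]
  linarith

lemma sum_priorWeight_ne_zero (p : ℝ) :
    ∑ x, priorWeight p x * (if x.1 ≠ 0 then 1 else 0) = p := by
  simp [priorWeight, triWeight, Fintype.sum_prod_type, Fin.sum_univ_three]
  ring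

lemma triNoise_mem_noiseClass (a τ : ℝ) :
    (atomic (triWeight (1 / 4))).map (fun x => √2 * triPoint x) ∈ noiseClass a τ := by
  have h2 : √2 * √2 = (2 : ℝ) := Real.mul_self_sqrt (by norm_num)
  have h2' : √2 < (2 : ℝ) := by nlinarith [Real.sqrt_nonneg (2 : ℝ)]
  refine map_atomic_mem_noiseClass (triWeight_nonneg (by norm_num) (by norm_num))
    (sum_triWeight _) ?_ ?_ fun t ht => ?_
  · simp [triWeight, triPoint, Fin.sum_univ_three]
  · simp [triWeight, triPoint, Fin.sum_univ_three]
    norm_num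
  · refine le_trans (le_of_eq (Finset.sum_eq_zero fun x _ => ?_)) (by positivity)
    rw [if_neg, mul_zero]
    have := abs_mul_triPoint_le (Real.sqrt_nonneg 2) x
    linarith

/-- The law of an observation under the sparse prior, tilted so that its second moment is `1`,
belongs to the class of noise laws: only the part of mass `p` exceeds `2`, and it stays below
`4 lam`. -/
lemma tilted_mem_noiseClass {a τ : ℝ} (ha : 0 < a) (hτ : 0 < τ) {p lam L : ℝ} (hp0 : 0 ≤ p)
    (hp1 : p ≤ 1 / 4) (hlam : 0 ≤ lam) (hε : p * lam ^ 2 / (1 - p) ≤ 1) (hL : 0 ≤ L)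
    (hpL : p ≤ 2 * Real.exp (-L)) (hlamL : 4 * lam ≤ τ * L ^ (1 / a)) :
    (∀ x, 0 ≤ priorWeight p x * (1 + p * lam ^ 2 / (1 - p) * bulkTilt x)) ∧
    (∑ x, priorWeight p x * (1 + p * lam ^ 2 / (1 - p) * bulkTilt x) = 1) ∧
    (atomic fun x => priorWeight p x * (1 + p * lam ^ 2 / (1 - p) * bulkTilt x)).map
      (observed lam) ∈ noiseClass a τ := by
  set ε := p * lam ^ 2 / (1 - p) with hεdef
  have h1p : 0 < 1 - p := by linarith
  have hε0 : 0 ≤ ε := by positivity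
  have hεp : ε * (1 - p) = p * lam ^ 2 := by rw [hεdef]; field_simp
  have h2 : √2 * √2 = (2 : ℝ) := Real.mul_self_sqrt (by norm_num)
  have hsq0 := Real.sqrt_nonneg (2 : ℝ)
  have h2' : √2 ≤ (3 / 2 : ℝ) := by nlinarith
  have htilt : ∀ x, |bulkTilt x| ≤ 1 := by
    rintro ⟨z, k⟩
    fin_cases z <;> fin_cases k <;> simp [bulkTilt]
  have hw0 : ∀ x, 0 ≤ priorWeight p x * (1 + ε * bulkTilt x) := fun x => by
    have h3 := (abs_le.mp (htilt x)).1
    exact mul_nonneg (priorWeight_nonneg hp0 (by linarith) x) (by nlinarith)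
  have hw1 : ∑ x, priorWeight p x * (1 + ε * bulkTilt x) = 1 := by
    simp only [mul_add, mul_one, Finset.sum_add_distrib, sum_priorWeight, mul_left_comm _ ε,
      ← Finset.mul_sum, sum_priorWeight_bulkTilt, mul_zero, add_zero]
  refine ⟨hw0, hw1, map_atomic_mem_noiseClass hw0 hw1 ?_ ?_ fun t ht => ?_⟩
  · simp [priorWeight, bulkTilt, triWeight, observed, triPoint, Fintype.sum_prod_type,
      Fin.sum_univ_three]
    ring
  · simp [priorWeight, bulkTilt, triWeight, observed, triPoint, Fintype.sum_prod_type,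
      Fin.sum_univ_three]
    ring_nf
    rw [Real.sq_sqrt (by norm_num)]
    linear_combination (-1 : ℝ) * hεp
  · have hbound : ∀ x : Fin 3 × Fin 3, t < |observed lam x| → x.1 ≠ 0 ∧ t < 4 * lam := by
      rintro ⟨z, k⟩ h
      have hk := abs_mul_triPoint_le hsq0 k
      have hz := abs_mul_triPoint_le hlam z
      have h3 := h.trans_le (abs_add_le _ _)
      simp only at h3
      refine ⟨fun h0 => ?_, by linarith⟩
      simp only at h0
      rw [h0] at h3
      simp only [triPoint, Matrix.cons_val_zero, mul_zero, abs_zero, zero_add] at h3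
      simp only [triPoint] at hk
      linarith
    by_cases htl : t < 4 * lam
    · calc ∑ x, priorWeight p x * (1 + ε * bulkTilt x) * (if t < |observed lam x| then 1 else 0)
          ≤ ∑ x, priorWeight p x * (if x.1 ≠ 0 then 1 else 0) := by
            refine Finset.sum_le_sum fun x _ => ?_
            have h4 := priorWeight_nonneg hp0 (by linarith : p ≤ 1) x
            by_cases h : t < |observed lam x|
            · have hx := (hbound x h).1
              simp [h, hx, bulkTilt]
            · simp only [h, if_false, mul_zero]
              positivity
        _ = p := sum_priorWeight_ne_zero p
        _ ≤ 2 * Real.exp (-L) := hpL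
        _ ≤ _ := by
            refine mul_le_mul_of_nonneg_left (Real.exp_le_exp.mpr (neg_le_neg ?_)) (by norm_num)
            have h5 : t / τ ≤ L ^ (1 / a) := by rw [div_le_iff₀ hτ]; linarith
            have h6 := Real.rpow_le_rpow (by positivity) h5 ha.le
            rwa [← Real.rpow_mul hL, one_div_mul_cancel ha.ne', Real.rpow_one] at h6
    · refine le_trans (le_of_eq (Finset.sum_eq_zero fun x _ => ?_)) (by positivity)
      rw [if_neg fun h => htl (hbound x h).2, mul_zero]

lemma l2norm_triSignal {d : ℕ} {b : ℝ} (hb : 0 ≤ b) (z : Fin d → Fin 3) :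
    l2norm (fun i => b * triPoint (z i)) = b * √((Finset.univ.filter fun i => z i ≠ 0).card) := by
  have h : ∀ i, (b * triPoint (z i)) ^ 2 = b ^ 2 * if z i ≠ 0 then 1 else 0 := by
    intro i
    rw [mul_pow]
    congr 1
    generalize z i = x
    fin_cases x <;> simp [triPoint]
  unfold l2norm
  rw [Finset.sum_congr rfl fun i _ => h i, ← Finset.mul_sum, Real.sqrt_mul (sq_nonneg b),
    Real.sqrt_sq hb, Finset.sum_boole]

lemma triSignal_mem_sparse {d s : ℕ} (b : ℝ) {z : Fin d → Fin 3}
    (hz : (Finset.univ.filter fun i => z i ≠ 0).card ≤ s) :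
    (fun i => b * triPoint (z i)) ∈ sparse d s := by
  refine (Finset.card_le_card fun i hi => ?_).trans hz
  simp only [Finset.mem_filter, Finset.mem_univ, true_and] at hi ⊢
  intro h
  simp [h, triPoint] at hi

/-- Conditioning on the signal indices `(ω i).1`: if every section of `A` over them lies in an event
of probability at most `δ` for the noise indices, then `A` has probability at most `δ`. -/
lemma sum_priorWeight_le {d : ℕ} {p δ : ℝ} (hp0 : 0 ≤ p) (hp1 : p ≤ 1) (hδ : 0 ≤ δ)
    (A : Finset (Fin d → Fin 3 × Fin 3)) (E : (Fin d → Fin 3) → Finset (Fin d → Fin 3))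
    (hA : ∀ ω ∈ A, (fun i => (ω i).2) ∈ E fun i => (ω i).1)
    (hE : ∀ ω ∈ A, ∑ k ∈ E fun i => (ω i).1, ∏ i, triWeight (1 / 4) (k i) ≤ δ) :
    ∑ ω ∈ A, ∏ i, priorWeight p (ω i) ≤ δ := by
  classical
  have hz0 : ∀ z : Fin d → Fin 3, 0 ≤ ∏ i, triWeight (p / 2) (z i) := fun z =>
    Finset.prod_nonneg fun i _ => triWeight_nonneg (by linarith) (by linarith) _
  have hk0 : ∀ k : Fin d → Fin 3, 0 ≤ ∏ i, triWeight (1 / 4) (k i) := fun k =>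
    Finset.prod_nonneg fun i _ => triWeight_nonneg (by norm_num) (by norm_num) _
  set e := Equiv.arrowProdEquivProdArrow (Fin d) (fun _ => Fin 3) (fun _ => Fin 3)
  calc ∑ ω ∈ A, ∏ i, priorWeight p (ω i)
      = ∑ ω, if ω ∈ A then ∏ i, priorWeight p (ω i) else 0 := by simp
    _ = ∑ z, ∑ k, if e.symm (z, k) ∈ A then ∏ i, priorWeight p (e.symm (z, k) i) else 0 := by
        rw [← Equiv.sum_comp e.symm, Fintype.sum_prod_type]
    _ ≤ ∑ z : Fin d → Fin 3, (∏ i, triWeight (p / 2) (z i)) * δ := by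
        refine Finset.sum_le_sum fun z _ => ?_
        by_cases hz : ∃ k, e.symm (z, k) ∈ A
        · obtain ⟨k₀, hk₀⟩ := hz
          refine le_trans ?_ (mul_le_mul_of_nonneg_left (hE _ hk₀) (hz0 z))
          rw [Finset.mul_sum]
          refine le_trans (Finset.sum_le_sum (g := fun k => if k ∈ E z then
            (∏ i, triWeight (p / 2) (z i)) * ∏ i, triWeight (1 / 4) (k i) else 0) fun k _ => ?_) ?_
          · by_cases hk : e.symm (z, k) ∈ A
            · have hkE : k ∈ E z := hA _ hk
              rw [if_pos hk, if_pos hkE, ← Finset.prod_mul_distrib]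
              exact le_rfl
            · rw [if_neg hk]
              split_ifs
              · exact mul_nonneg (hz0 z) (hk0 k)
              · exact le_rfl
          · rw [← Finset.sum_filter, Finset.filter_mem_eq_inter, Finset.univ_inter]
            exact le_rfl
        · push Not at hz
          rw [Finset.sum_eq_zero fun k _ => if_neg (hz k)]
          exact mul_nonneg (hz0 z) hδ
    _ = δ := by
        rw [← Finset.sum_mul, sum_prod_eq_one (sum_triWeight _), one_mul]

/-- The lower bound for the risk of every estimator. -/
lemma exists_le_risk {a τ : ℝ} (ha : 0 < a) (hτ : 0 < τ) {ℓ : ℝ≥0 → ℝ≥0} (hℓ : ℓ ∈ lossClass) :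
    ∃ c c' : ℝ, 0 < c ∧ 0 < c' ∧ ∀ (s d : ℕ) (σ : ℝ), 1 ≤ s → s ≤ d → 0 < σ →
      ENNReal.ofReal c' ≤ ⨅ T ∈ {T : (Fin d → ℝ) → ℝ | Measurable T},
        ⨆ P ∈ noiseClass a τ, ⨆ θ ∈ sparse d s,
          ∫⁻ y, (ℓ (Real.toNNReal (c * (rate a s d)⁻¹ * |(T y - l2norm θ) / σ|)) : ℝ≥0∞)
            ∂(law θ P σ) := by
  obtain ⟨hmono, -, t₀, ht₀⟩ := hℓ
  have hℓ0 : (0 : ℝ) < ℓ t₀ := by exact_mod_cast pos_iff_ne_zero.mpr ht₀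
  -- `κ ≤ 1 / 8` makes the tilt at most `1 / (64 √d)`, and `κ ≤ τ / 4` ensures the tail condition
  set κ : ℝ := min (1 / 8) (τ / 4) with hκ
  have hκ0 : 0 < κ := lt_min (by norm_num) (by positivity)
  have hκ8 : κ ≤ 1 / 8 := min_le_left _ _
  have hκτ : κ ≤ τ / 4 := min_le_right _ _
  refine ⟨8 * (t₀ + 1) / κ, ℓ t₀ / 128, by positivity, by positivity, fun s d σ hs hsd hσ => ?_⟩
  refine le_iInf₂ fun T hT => ?_
  by_contra! hlt
  have hs0 : (1 : ℝ) ≤ s := by exact_mod_cast hs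
  have hsd' : (s : ℝ) ≤ d := by exact_mod_cast hsd
  have hd0 : (0 : ℝ) < d := by linarith
  have hφ := rate_pos (a := a) hs hsd
  have hφ2 := rate_sq (a := a) hs hsd
  set φ := rate a s d with hφdef
  have hL := one_le_log_exp_mul_div (by linarith) hsd'
  have hLexp : Real.exp (-Real.log (Real.exp 1 * d / s)) = s / (Real.exp 1 * d) := by
    rw [Real.exp_neg, Real.exp_log (by positivity), inv_div]
  set L := Real.log (Real.exp 1 * d / s) with hLdef
  have hsq : 0 < √(s : ℝ) := Real.sqrt_pos.mpr (by linarith)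
  have hsqs : √(s : ℝ) * √s = s := Real.mul_self_sqrt (by linarith)
  set lam := κ * φ / √s with hlamdef
  have hlam0 : 0 < lam := by positivity
  have hlams : lam * √s = κ * φ := by rw [hlamdef]; field_simp
  have hlam2 : lam ^ 2 * s ≤ √d / 64 := by
    have e1 : lam ^ 2 * s = κ ^ 2 * φ ^ 2 := by
      rw [← mul_pow, ← hlams, mul_pow, sq √(s : ℝ), hsqs]
    have h1 : φ ^ 2 ≤ √d := by rw [hφ2]; exact min_le_right _ _
    have h2 : κ ^ 2 ≤ (1 / 8) ^ 2 := pow_le_pow_left₀ hκ0.le hκ8 2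
    rw [e1]
    calc κ ^ 2 * φ ^ 2 ≤ (1 / 8) ^ 2 * √d := mul_le_mul h2 h1 (sq_nonneg _) (by norm_num)
      _ = _ := by ring
  have hlamL : 4 * lam ≤ τ * L ^ (1 / a) := by
    have h1 : φ ≤ √s * L ^ (1 / a) := min_le_left _ _
    have h2 : lam ≤ κ * L ^ (1 / a) := by
      rw [hlamdef, div_le_iff₀ hsq]
      calc κ * φ ≤ κ * (√s * L ^ (1 / a)) := mul_le_mul_of_nonneg_left h1 hκ0.le
        _ = _ := by ring
    have h3 : κ * L ^ (1 / a) ≤ τ / 4 * L ^ (1 / a) :=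
      mul_le_mul_of_nonneg_right hκτ (by positivity)
    linarith
  set p : ℝ := s / (4 * d) with hp
  have hp0 : 0 ≤ p := by positivity
  have hp1 : p ≤ 1 / 4 := by
    rw [hp, div_le_div_iff₀ (by positivity) (by norm_num)]; linarith
  have hpL : p ≤ 2 * Real.exp (-L) := by
    rw [hLexp, hp, ← mul_div_assoc, div_le_div_iff₀ (by positivity) (by positivity)]
    have h3 : Real.exp 1 ≤ 8 := by have := Real.exp_one_lt_d9; linarith
    have h4 : Real.exp 1 * (s * d) ≤ 8 * (s * d) :=
      mul_le_mul_of_nonneg_right h3 (by positivity)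
    linarith
  set ε := p * lam ^ 2 / (1 - p) with hε
  have hε0 : 0 ≤ ε := by
    rw [hε]; exact div_nonneg (by positivity) (by linarith)
  have hsqd : √(d : ℝ) * √d = d := Real.mul_self_sqrt hd0.le
  have hsqd1 : 1 ≤ √(d : ℝ) := Real.one_le_sqrt.mpr (by linarith)
  have hεd : ε * √d ≤ 1 / 64 := by
    have e1 : p * lam ^ 2 * √d = lam ^ 2 * s * √d / (4 * d) := by rw [hp]; ring
    have h1 : p * lam ^ 2 * √d ≤ 1 / 256 := by
      rw [e1, div_le_iff₀ (by positivity)]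
      have := mul_le_mul_of_nonneg_right hlam2 (Real.sqrt_nonneg (d : ℝ))
      nlinarith
    rw [hε, div_mul_eq_mul_div, div_le_iff₀ (by linarith)]
    linarith
  have hε1 : ε ≤ 1 := by nlinarith
  obtain ⟨hw0, hw1, hP1⟩ := tilted_mem_noiseClass ha hτ hp0 hp1 hlam0.le hε1 (by linarith) hpL hlamL
  rw [← hε] at hw0 hw1 hP1
  set Δ := lam * √s / 8 with hΔ
  have hb : 0 ≤ 8 * ((t₀ : ℝ) + 1) / κ * φ⁻¹ := by positivity
  have hbΔ : (t₀ : ℝ) ≤ 8 * ((t₀ : ℝ) + 1) / κ * φ⁻¹ * Δ := by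
    have e1 : 8 * ((t₀ : ℝ) + 1) / κ * φ⁻¹ * Δ = t₀ + 1 := by
      rw [hΔ, hlams]; field_simp
    linarith
  have hreal : ∀ {x : ℝ}, ENNReal.ofReal (ℓ t₀ * x) < ENNReal.ofReal (ℓ t₀ / 128) → x ≤ 1 / 128 := by
    intro x hx
    have h1 := (ENNReal.ofReal_lt_ofReal_iff (by positivity)).mp hx
    have h2 : (ℓ t₀ : ℝ) * x < ℓ t₀ * (1 / 128) := by linarith
    exact (lt_of_mul_lt_mul_left h2 hℓ0.le).le
  classical
  -- the event on which the estimator reports a signal, under the tilted noise and `θ = 0`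
  set A₁ : Finset (Fin d → Fin 3 × Fin 3) := Finset.univ.filter fun ω =>
    σ * Δ ≤ |T (fun i => 0 + σ * observed lam (ω i)) - 0| with hA₁
  have h1 : ∑ ω ∈ A₁, ∏ i, (priorWeight p (ω i) * (1 + ε * bulkTilt (ω i))) ≤ 1 / 128 := by
    refine hreal (lt_of_le_of_lt (le_trans ?_ (le_iSup₂_of_le _ hP1
      (le_iSup₂_of_le (fun _ => (0 : ℝ)) (by simp [sparse]) le_rfl))) hlt)
    have hn : l2norm (fun _ : Fin d => (0 : ℝ)) = 0 := by simp [l2norm]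
    rw [hn]
    exact le_risk_atomic hw0 hw1 (observed lam) (fun _ => 0) hσ hmono hb hbΔ hT 0 A₁
      fun ω hω => (Finset.mem_filter.mp hω).2
  -- the event on which the estimator misses the signal, given the signal
  set E : (Fin d → Fin 3) → Finset (Fin d → Fin 3) := fun z => Finset.univ.filter fun k =>
    σ * Δ ≤ |T (fun i => σ * lam * triPoint (z i) + σ * (√2 * triPoint (k i))) -
      l2norm fun i => σ * lam * triPoint (z i)| with hE
  have h2 : ∀ z : Fin d → Fin 3, (Finset.univ.filter fun i => z i ≠ 0).card ≤ s →
      ∑ k ∈ E z, ∏ i, triWeight (1 / 4) (k i) ≤ 1 / 128 := by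
    intro z hz
    refine hreal (lt_of_le_of_lt (le_trans ?_ (le_iSup₂_of_le _ (triNoise_mem_noiseClass a τ)
      (le_iSup₂_of_le _ (triSignal_mem_sparse (σ * lam) hz) le_rfl))) hlt)
    exact le_risk_atomic (triWeight_nonneg (by norm_num) (by norm_num)) (sum_triWeight _) _ _ hσ
      hmono hb hbΔ hT _ (E z) fun k hk => (Finset.mem_filter.mp hk).2
  set G : Finset (Fin d → Fin 3 × Fin 3) := Finset.univ.filter fun ω =>
    (Finset.univ.filter fun i => (ω i).1 ≠ 0).card ≤ s ∧
      s ≤ 16 * (Finset.univ.filter fun i => (ω i).1 ≠ 0).card with hG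
  have hG1 : 1 / 16 ≤ ∑ ω ∈ G, ∏ i, priorWeight p (ω i) :=
    le_sum_prod_count (priorWeight_nonneg hp0 (by linarith)) (sum_priorWeight p)
      (fun x : Fin 3 × Fin 3 => x.1 ≠ 0) hs (by omega) (sum_priorWeight_ne_zero p)
  have h3 : ∑ ω ∈ G \ A₁, ∏ i, priorWeight p (ω i) ≤ 1 / 128 := by
    refine sum_priorWeight_le hp0 (by linarith) (by norm_num) _ E (fun ω hω => ?_) fun ω hω => ?_
    · obtain ⟨hωG, hωA⟩ := Finset.mem_sdiff.mp hω
      obtain ⟨-, -, hcard⟩ := Finset.mem_filter.mp hωG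
      simp only [hA₁, Finset.mem_filter, Finset.mem_univ, true_and, not_le, sub_zero] at hωA
      refine Finset.mem_filter.mpr ⟨Finset.mem_univ _, ?_⟩
      have hfun : (fun i => σ * lam * triPoint (ω i).1 + σ * (√2 * triPoint (ω i).2)) =
          fun i => 0 + σ * observed lam (ω i) := by
        ext i; simp only [observed]; ring
      simp only [hfun]
      rw [l2norm_triSignal (by positivity) fun i => (ω i).1]
      set N := (Finset.univ.filter fun i => (ω i).1 ≠ 0).card
      have h4 : √(s : ℝ) ≤ 4 * √N := by
        rw [show (4 : ℝ) = √16 by rw [show (16 : ℝ) = 4 ^ 2 by norm_num]; simp,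
          ← Real.sqrt_mul (by norm_num)]
        exact Real.sqrt_le_sqrt (by exact_mod_cast hcard)
      have h5 := mul_le_mul_of_nonneg_left h4 (by positivity : 0 ≤ σ * lam)
      have h6 : σ * Δ = σ * lam * √s / 8 := by rw [hΔ]; ring
      have h7 := neg_abs_le (T (fun i => 0 + σ * observed lam (ω i)) - σ * lam * √N)
      have h8 := (abs_lt.mp hωA).2
      linarith
    · exact h2 _ (Finset.mem_filter.mp (Finset.mem_sdiff.mp hω).1).2.1
  have hTV := sum_prod_sub_le (priorWeight_nonneg hp0 (by linarith)) (sum_priorWeight p)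
    (sum_priorWeight_bulkTilt p) (sum_priorWeight_bulkTilt_sq hp0) (ε := ε) A₁
  have hTV2 : √(Real.exp (d * ε ^ 2) - 1) ≤ 1 / 32 := by
    have e1 : d * ε ^ 2 = (ε * √d) ^ 2 := by rw [mul_pow, sq √(d : ℝ), hsqd]; ring
    have h4 : d * ε ^ 2 ≤ (1 / 64) ^ 2 := by
      rw [e1]; exact pow_le_pow_left₀ (by positivity) hεd 2
    have h5 : 0 ≤ d * ε ^ 2 := by positivity
    have h6 := (abs_le.mp (Real.abs_exp_sub_one_le (x := d * ε ^ 2)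
      (by rw [abs_of_nonneg h5]; linarith))).2
    rw [abs_of_nonneg h5] at h6
    refine Real.sqrt_le_iff.mpr ⟨by norm_num, ?_⟩
    linarith
  have h4 : ∑ ω ∈ G, ∏ i, priorWeight p (ω i) ≤
      ∑ ω ∈ G \ A₁, ∏ i, priorWeight p (ω i) + ∑ ω ∈ A₁, ∏ i, priorWeight p (ω i) := by
    rw [← Finset.sum_union Finset.sdiff_disjoint]
    refine Finset.sum_le_sum_of_subset_of_nonneg (fun ω hω => ?_) fun ω _ _ =>
      Finset.prod_nonneg fun i _ => priorWeight_nonneg hp0 (by linarith) _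
    by_cases h : ω ∈ A₁ <;> simp [h, hω]
  linarith

end SparseNorm

theorem mainTheorem10 (a τ : ℝ) (ha : 0 < a) (hτ : 0 < τ) :
    (∃ γ c C : ℝ, 0 < γ ∧ γ ≤ 1 / 2 ∧ 0 < c ∧ 0 < C ∧
      ∀ (s d : ℕ) (σ : ℝ), 1 ≤ s → (s : ℝ) < (⌊γ * (d : ℝ)⌋₊ : ℝ) / 4 → 0 < σ →
      ∀ B : Fin ⌊γ * (d : ℝ)⌋₊ → Finset (Fin d), SparseNorm.IsBlockPartition B →
      ∀ v : (Fin d → ℝ) → ℝ, SparseNorm.IsMedianOfMeans B v →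
      ∀ θhat : (Fin d → ℝ) → (Fin d → ℝ),
        SparseNorm.IsSlopeEstimator (SparseNorm.weight a c d) v θhat →
        (⨆ P ∈ SparseNorm.noiseClass a τ, ⨆ θ ∈ SparseNorm.sparse d s,
          ∫⁻ y, ENNReal.ofReal
            ((SparseNorm.normEstimator a σ s θhat y - SparseNorm.l2norm θ) ^ 2)
            ∂(SparseNorm.law θ P σ))
          ≤ ENNReal.ofReal (C * σ ^ 2 * SparseNorm.rate a s d ^ 2)) ∧
    (∀ ℓ ∈ SparseNorm.lossClass, ∃ c c' : ℝ, 0 < c ∧ 0 < c' ∧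
      ∀ (s d : ℕ) (σ : ℝ), 1 ≤ s → s ≤ d → 0 < σ →
        ENNReal.ofReal c' ≤
          ⨅ T ∈ {T : (Fin d → ℝ) → ℝ | Measurable T},
            ⨆ P ∈ SparseNorm.noiseClass a τ, ⨆ θ ∈ SparseNorm.sparse d s,
              ∫⁻ y, (ℓ (Real.toNNReal
                (c * (SparseNorm.rate a s d)⁻¹ * |(T y - SparseNorm.l2norm θ) / σ|)) : ℝ≥0∞)
                ∂(SparseNorm.law θ P σ)) :=
  ⟨SparseNorm.exists_risk_le ha hτ, fun _ hℓ => SparseNorm.exists_le_risk ha hτ hℓ⟩
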